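/- **Conventions.** Let $\Delta,\mathcal C$ be disjoint sets of broadcast and binary channels, and $Act=\{\delta!,\delta?\mid\delta\in\Delta\}\cup\{c!,c?\mid c\in\mathcal C\}\cup\{\tau\}\cup\mathbb R_{\ge0}$. Variables are typed; some of them are clocks, with domain $\mathbb R_{\ge 0}$. $Val(V)$ is the set of type-respecting valuations of a set $V$ of variables; $v\oplus d$ increases all clocks of $v$ by $d$. For functions $f,g$: $f\lceil Z$ is the restriction to $Z$; $f\heartsuit g$ means that $f,g$ agree on $dom f\cap dom g$; $f\rhd g$ is defined on $dom f\cup dom g$ as $f$ on $dom f$ and $g$ elsewhere; $f\lhd g=g\rhd f$; $f\|g=f\rhd g$ if $f\heartsuit g$; $f[g]=(f\lhd g)\lceil dom f$. For $P\subseteq Val(V)$ and $v$ defined on a superset of $V$, $v\models P$ means $v\lceil V\in P$; $P$ does not depend on $Z\subseteq V$ if $v\models P\Leftrightarrow v[u]\models P$ for all $v\in Val(V)$, $u\in Val(Z)$. An LTS is a set of states with an initial state and a transition relation contained in $S\times Act\times S$. **Timed automata.** A timed automaton $\mathcal A=\langle L,K,l^0,E,H,v^0,I,\to,\to^u\rangle$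 has locations $L$, committed locations $K\subseteq L$, an initial location $l^0$, disjoint sets $E,H$ of external and internal variables ($V=E\cup H$), an initial valuation $v^0\in Val(V)$, invariants $I(l)\subseteq Val(V)$ that are left-closed ($v\oplus d\in I(l)\Rightarrow v\in I(l)$) with $v^0\in I(l^0)$, transitions $l\xrightarrow{g,a,\rho}l'$ with $a\in Act\setminus\mathbb R_{\ge0}$, $\rho:Val(V)\to Val(V)$ and guard $g\subseteq Val(V)$ a conjunction of comparisons of clocks and of differences of clocks with constants and of a condition not depending on clocks, and a subset $\to^u$ of urgent transitions. For a state $s$ defined on a superset of $V$, $\rho(s)=s[\rho(s\lceil V)]$. A network $\mathcal N=\langle\mathcal A_1,\dots,\mathcal A_n\rangle$, $n\ge1$, consists of timed automata with $H_i\cap V_j=\emptyset$ and $v^0_i\heartsuit v^0_j$ for $i\ne j$. Let $\mathsf{loc}_i$ be pairwise distinct fresh non-clock variables of type $L_i$, and $W_i=V_i\cup\{\mathsf{loc}_i\}$. **Non-compositional semantics.** $\mathsf{LTS}(\mathcal N)$ has the states $S=\{v\in Val(\bigcup_iW_i)\mid\forall i: v\models I_i(v(\mathsf{loc}_i))\}$,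 the initial state $v_1^0\|\cdots\|v_n^0\|\{\mathsf{loc}_i\mapsto l_i^0\}_i$, and the following transitions between states $s,s'\in S$. Let $nc(s)$ mean $s(\mathsf{loc}_k)\notin K_k$ for all $k$, and let $RS(\delta,i,s)$ be the set of all $j\ne i$ for which $\mathcal A_j$ has a transition $s(\mathsf{loc}_j)\xrightarrow{g,\delta?,\rho}l'$ with $s\models g$. * TAU: $s\xrightarrow{\tau}\rho(s)[\mathsf{loc}_i\mapsto l']$ if $l\xrightarrow{g,\tau,\rho}_il'$, $s(\mathsf{loc}_i)=l$, $s\models g$, and $nc(s)$ or $l\in K_i$. * SYNC: $s\xrightarrow{\tau}\rho_j(\rho_i(s))[\mathsf{loc}_i\mapsto l_i',\mathsf{loc}_j\mapsto l_j']$ if $i\neq j$, $l_i\xrightarrow{g_i,c!,\rho_i}_il_i'$, $l_j\xrightarrow{g_j,c?,\rho_j}_jl_j'$, $s(\mathsf{loc}_i)=l_i$, $s(\mathsf{loc}_j)=l_j$, $s\models g_i$, $s\models g_j$, and $nc(s)$ or $l_i\in K_i$ or $l_j\in K_j$. * TIME: $s\xrightarrow{d}s\oplus d$ if $nc(s)$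 and there is no urgent $\tau$-transition of any $\mathcal A_i$ from $s(\mathsf{loc}_i)$ whose guard holds in $s$. * BCST: if $l_i\xrightarrow{g_i,\delta!,\rho_i}_il_i'$, $s(\mathsf{loc}_i)=l_i$, $s\models g_i$, and for every $j\in RS(\delta,i,s)=\{j_1<\dots<j_m\}$ a transition $l_j\xrightarrow{g_j,\delta?,\rho_j}_jl_j'$ with $s(\mathsf{loc}_j)=l_j$, $s\models g_j$ is chosen, and $nc(s)$ or $l_i\in K_i$ or $l_j\in K_j$ for some $j\in RS(\delta,i,s)$, then $s\xrightarrow{\tau}\rho_{j_m}(\cdots\rho_{j_1}(\rho_i(s)))[\mathsf{loc}_i\mapsto l_i',\mathsf{loc}_{j_1}\mapsto l_{j_1}',\dots,\mathsf{loc}_{j_m}\mapsto l'_{j_m}]$. **Compositional semantics.** A TTSB $\langle E,H,S,s^0,Act,\to^1,\to^0\rangle$ has committed ($\xrightarrow{a,1}$) and uncommitted ($\xrightarrow{a,0}$) transitions; $Comm(s)$ means that some committed transition starts in $s$; $\mathsf{LTS}(\mathcal T)$ has the states of $\mathcal T$ and the transitions $\to^1\cup\to^0$. $\mathsf{TTSB}(\mathcal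 A)$ has external variables $E$, internal variables $H\cup\{\mathsf{loc}\}$, states $\{v\in Val(V\cup\{\mathsf{loc}\})\mid v\models I(v(\mathsf{loc}))\}$, initial state $v^0\|\{\mathsf{loc}\mapsto l^0\}$, and the following transitions between its states: * ACT: $s\xrightarrow{a,b}\rho(s)[\mathsf{loc}\mapsto l']$ if $l\xrightarrow{g,a,\rho}l'$, $s(\mathsf{loc})=l$, $s\models g$, where $b\Leftrightarrow l\in K$. * TIME: $s\xrightarrow{d,0}s\oplus d$ if $s(\mathsf{loc})\notin K$ and no urgent $\tau$-transition from $s(\mathsf{loc})$ has a guard that holds in $s$. * VIRT: $s\xrightarrow{\delta?,0}s$ if no $\delta?$-transition from $s(\mathsf{loc})$ has a guard that holds in $s$. $\mathcal T_1\|\mathcal T_2$ has external variables $E_1\cup E_2$, internal variables $H_1\cup H_2$, states $r\|s$ with $r\in S_1,s\in S_2,r\heartsuit s$, initial state $s_1^0\|s_2^0$, and for $\{i,j\}=\{1,2\}$, $r\in S_i$, $s\in S_j$, $r\heartsuit s$ the transitions * EXT: $r\|s\xrightarrow{a,b}r'\rhd s$ if $a\in\{c!,c?\mid c\in\mathcal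 C\}$ and $r\xrightarrow{a,b}_ir'$; * TAU: $r\|s\xrightarrow{\tau,b}r'\rhd s$ if $r\xrightarrow{\tau,b}_ir'$ and $Comm(s)\Rightarrow b$; * SYNC: $r\|s\xrightarrow{\tau,b\vee b'}r'\lhd s'$ if $r\xrightarrow{c!,b}_ir'$, $s[r']\xrightarrow{c?,b'}_js'$ and $Comm(r)\vee Comm(s)\Rightarrow b\vee b'$; * TIME: $r\|s\xrightarrow{d,0}r'\|s'$ if $r\xrightarrow{d,0}_ir'$, $s\xrightarrow{d,0}_js'$; * SND: $r\|s\xrightarrow{\delta!,b\vee b'}r'\|s'$ if $r\xrightarrow{\delta!,b}_ir'$, $s[r']\xrightarrow{\delta?,b'}_js'$; * RCV: $r\|s\xrightarrow{\delta?,b\vee b'}r'\|s'$ if $r\xrightarrow{\delta?,b}_ir'$, $s\xrightarrow{\delta?,b'}_js'$. $\mathcal T\backslash(\Delta\cup\mathcal C)$ arises from $\mathcal T$ by removing all transitions labeled $\delta?$, $c!$, $c?$, removing every $s\xrightarrow{\delta!,b}s'$ with $Comm(s)\wedge\neg b$, and replacing every other $s\xrightarrow{\delta!,b}s'$ by $s\xrightarrow{\tau,b}s'$.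 The composition of $n$ TTSBs is bracketed to the left. **Theorem.** Let $\mathcal N=\langle\mathcal A_1,\dots,\mathcal A_n\rangle$ be a network of timed automata such that every $\mathcal A=\mathcal A_i$ satisfies: * (VII) $I(l)$ does not depend on $E$, for every $l$; * (VIII) if $l\xrightarrow{g,\sigma?,\rho}l'$ with $\sigma\in\Delta\cup\mathcal C$, then $g$ does not depend on $E$; * (IX) for all $l\in K$ and $v\in I(l)$ there is $l\xrightarrow{g,a,\rho}l'$ with $v\in g$ and $\rho(v)\in I(l')$; * (X) urgent transitions have action $\tau$ and a guard that does not depend on clocks; * (XI) if $l\xrightarrow{g,\delta?,\rho}l'$ with $\delta\in\Delta$, then $\rho(v)\lceil E=v\lceil E$ for all $v\in Val(V)$; * (broadcast inputs lead to legal states) if $v\in I(l)$ and the guard of some $\delta?$-transition from $l$ holds in $v$, then some $l\xrightarrow{g,\delta?,\rho}l'$ satisfies $v\in g$ and $\rho(v)\in I(l')$. Then $$\mathsf{LTS}(\mathcal N)\;\cong\;\mathsf{LTS}\bigl((\mathsf{TTSB}(\mathcal A_1)\|\cdots\|\mathsf{TTSB}(\mathcal A_n))\backslash(\Delta\cup\mathcal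 C)\bigr),$$ i.e. there is a bijection between the states that maps the initial state to the initial state and preserves and reflects all transitions. -/

import Mathlib

open scoped NNReal

noncomputable section

namespace BroadcastTA

/-! ### Typed variables and partial valuations -/

/-- The universal set of variables: clocks `x : X` and all other variables `y : Y`. -/
inductive Var (X Y : Type*) where
  | clock (x : X)
  | data (y : Y)

/-- Domains of the variables: `ℝ≥0` for a clock, `D y` for any other variable `y`. -/
abbrev Var.Dom {X Y : Type*} (D : Y → Type) : Var X Y → Type
  | .clock _ => ℝ≥0
  | .data y => D y

/-- The set of all clocks. -/
def clocks (X Y : Type*) : Set (Var X Y) := Set.range Var.clock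

/-- Functions whose domain is a set of variables and which respect the types; `none` means
that the variable is not in the domain. -/
abbrev PVal (X : Type*) {Y : Type*} (D : Y → Type) := (x : Var X Y) → Option (x.Dom D)

namespace PVal

variable {X Y : Type*} {D : Y → Type}

/-- The domain `dom f`. -/
def dom (f : PVal X D) : Set (Var X Y) := {x | (f x).isSome}

/-- The function with empty domain. -/
def empty : PVal X D := fun _ => none

open Classical in
/-- The restriction `f⌈Z`. -/
def restrict (f : PVal X D) (Z : Set (Var X Y)) : PVal X D :=
  fun x => if x ∈ Z then f x else none

/-- The override `f ▷ g`, which prefers `f`. On compatible functions it is the merge `f ‖ g`. -/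
def override (f g : PVal X D) : PVal X D := fun x => (f x).or (g x)

/-- Compatibility `f ♡ g`. -/
def Compat (f g : PVal X D) : Prop := ∀ x ∈ f.dom ∩ g.dom, f x = g x

/-- The update `f[g] = (g ▷ f)⌈dom f`. -/
def update (f g : PVal X D) : PVal X D := (g.override f).restrict f.dom

open Classical in
/-- The valuation `{y ↦ a}`. -/
def single (y : Y) (a : D y) : PVal X D
  | .clock _ => none
  | .data z => if h : y = z then some (h ▸ a) else none

/-- `v ⊕ d`: every clock in the domain is increased by `d`. -/
def delay (v : PVal X D) (d : ℝ≥0) : PVal X D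
  | .clock x => Option.map (fun t : ℝ≥0 => t + d) (v (.clock x))
  | .data y => v (.data y)

/-- `f_0 ‖ ⋯ ‖ f_n` (for pairwise compatible functions). -/
def mergeAll : {n : ℕ} → (Fin (n + 1) → PVal X D) → PVal X D
  | 0, f => f 0
  | _ + 1, f => (mergeAll fun i => f i.castSucc).override (f (Fin.last _))

end PVal

section Properties

variable {X Y : Type*} {D : Y → Type}

/-- The set of valuations for `V`. -/
def Val (V : Set (Var X Y)) : Set (PVal X D) := {v | v.dom = V}

/-- A property `P` over `V` is left-closed. -/
def LeftClosed (V : Set (Var X Y)) (P : Set (PVal X D)) : Prop :=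
  ∀ v ∈ (Val V : Set (PVal X D)), ∀ d : ℝ≥0, v.delay d ∈ P → v ∈ P

/-- A property `P` over `V` does not depend on the variables in `W ⊆ V`. -/
def NotDependOn (V W : Set (Var X Y)) (P : Set (PVal X D)) : Prop :=
  ∀ v ∈ (Val V : Set (PVal X D)), ∀ u ∈ (Val W : Set (PVal X D)), v ∈ P ↔ v.update u ∈ P

/-- The property `P` over `V` holds in `v`, for `v` defined on a superset of `V`. -/
def Holds (V : Set (Var X Y)) (P : Set (PVal X D)) (v : PVal X D) : Prop := v.restrict V ∈ P

/-- Comparison operators. -/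
inductive Cmp where
  | lt | le | eq | ge | gt

/-- The relation on the reals denoted by a comparison operator. -/
def Cmp.rel : Cmp → ℝ → ℝ → Prop
  | .lt, a, b => a < b
  | .le, a, b => a ≤ b
  | .eq, a, b => a = b
  | .ge, a, b => a ≥ b
  | .gt, a, b => a > b

/-- Simple conditions `x ⋈ k` on clocks and `x - y ⋈ k` on differences between clocks. -/
inductive ClockCond (X : Type*) where
  | single (x : X) (c : Cmp) (k : ℝ)
  | diff (x y : X) (c : Cmp) (k : ℝ)

/-- Satisfaction of a clock condition (false if one of its clocks has no value). -/
def ClockCond.Sat : ClockCond X → PVal X D → Prop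
  | .single x c k, v => ∃ s : ℝ≥0, v (.clock x) = some s ∧ c.rel s k
  | .diff x y c k, v =>
      ∃ s t : ℝ≥0, v (.clock x) = some s ∧ v (.clock y) = some t ∧ c.rel ((s : ℝ) - t) k

/-- `g` is a guard over `V`: a conjunction of simple conditions on clocks and clock differences
and of a condition `B` that does not involve clocks. -/
def IsGuard (V : Set (Var X Y)) (g : Set (PVal X D)) : Prop :=
  ∃ (cs : List (ClockCond X)) (B : Set (PVal X D)),
    NotDependOn V (V ∩ clocks X Y) B ∧
    g = {v | v ∈ (Val V : Set (PVal X D)) ∧ (∀ c ∈ cs, c.Sat v) ∧ v ∈ B}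

end Properties

/-! ### Actions and labeled transition systems -/

/-- The actions `δ!`, `δ?` (broadcast channels `δ : Δ`), `c!`, `c?` (binary channels `c : C`)
and the internal action `τ`. -/
inductive DAct (Δ C : Type*) where
  | bsend (δ : Δ)
  | brecv (δ : Δ)
  | csend (c : C)
  | crecv (c : C)
  | tau

/-- The action set `Act`: the actions above and the time-passage actions `d ∈ ℝ≥0`. -/
inductive Act (Δ C : Type*) where
  | disc (a : DAct Δ C)
  | delay (d : ℝ≥0)

/-- Labeled transition systems with action set `A`. -/
structure LTS (A : Type*) where
  State : Type*
  init : State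
  tr : State → A → State → Prop

/-- Isomorphisms of labeled transition systems. -/
structure LTS.Iso {A : Type*} (L₁ L₂ : LTS A) where
  toEquiv : L₁.State ≃ L₂.State
  map_init : toEquiv L₁.init = L₂.init
  map_tr : ∀ s a t, L₁.tr s a t ↔ L₂.tr (toEquiv s) a (toEquiv t)

/-! ### Timed automata -/

/-- Timed automata. The set of locations `L` is the domain `D loc` of a variable `loc` that is
fresh, i.e. does not occur among the external and internal variables. -/
structure TA (X : Type*) {Y : Type*} (D : Y → Type) (Δ C : Type*) where
  /-- the fresh location variable, with type `L = D loc` -/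
  loc : Y
  /-- the committed locations -/
  K : Set (D loc)
  /-- the initial location -/
  l0 : D loc
  /-- the external variables -/
  E : Set (Var X Y)
  /-- the internal variables -/
  H : Set (Var X Y)
  disjoint_EH : Disjoint E H
  loc_fresh : Var.data loc ∉ E ∪ H
  /-- the initial valuation -/
  v0 : PVal X D
  v0_mem : v0 ∈ (Val (E ∪ H) : Set (PVal X D))
  /-- the location invariants -/
  I : D loc → Set (PVal X D)
  I_subset : ∀ l, I l ⊆ Val (E ∪ H)
  I_leftClosed : ∀ l, LeftClosed (E ∪ H) (I l)
  v0_inv : v0 ∈ I l0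
  /-- `tr l g a ρ l'` is the transition from `l` to `l'` with guard `g`, action `a` and
  update function `ρ` -/
  tr : D loc → Set (PVal X D) → DAct Δ C → (PVal X D → PVal X D) → D loc → Prop
  tr_guard : ∀ {l g a ρ l'}, tr l g a ρ l' → IsGuard (E ∪ H) g
  tr_update : ∀ {l g a ρ l'}, tr l g a ρ l' →
    Set.MapsTo ρ (Val (E ∪ H) : Set (PVal X D)) (Val (E ∪ H) : Set (PVal X D))
  /-- the urgent transitions -/
  urgent : D loc → Set (PVal X D) → DAct Δ C → (PVal X D → PVal X D) → D loc → Prop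
  urgent_tr : ∀ {l g a ρ l'}, urgent l g a ρ l' → tr l g a ρ l'

namespace TA

variable {X Y : Type*} {D : Y → Type} {Δ C : Type*}

/-- `V = E ∪ H`. -/
def V (A : TA X D Δ C) : Set (Var X Y) := A.E ∪ A.H

/-- `W = E ∪ H ∪ {loc}`. -/
def W (A : TA X D Δ C) : Set (Var X Y) := A.E ∪ A.H ∪ {Var.data A.loc}

/-- `s(loc) = l`. -/
def At (A : TA X D Δ C) (s : PVal X D) (l : D A.loc) : Prop := s (Var.data A.loc) = some l

/-- `s(loc) ∈ K`. -/
def InCommitted (A : TA X D Δ C) (s : PVal X D) : Prop := ∃ l ∈ A.K, A.At s l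

/-- An update function `ρ` of `A`, applied to a state `s` that is defined on a superset of
`V`: `ρ(s) = s[ρ(s⌈V)]`. -/
def apply (A : TA X D Δ C) (ρ : PVal X D → PVal X D) (s : PVal X D) : PVal X D :=
  s.update (ρ (s.restrict A.V))

/-- The location part `{loc ↦ l}`. -/
def locVal (A : TA X D Δ C) (l : D A.loc) : PVal X D := PVal.single A.loc l

/-- Compatibility of timed automata; the last three conditions express that the location
variable of one automaton is fresh also with respect to the other automaton. -/
structure Compatible (A B : TA X D Δ C) : Prop where
  left : A.H ∩ B.V = ∅
  right : B.H ∩ A.V = ∅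
  init : A.v0.Compat B.v0
  loc_ne : A.loc ≠ B.loc
  loc_left : Var.data A.loc ∉ B.V
  loc_right : Var.data B.loc ∉ A.V

/-- The axioms imposed on timed automata. -/
structure Axioms (A : TA X D Δ C) : Prop where
  /-- invariants do not depend on external variables -/
  inv : ∀ l, NotDependOn A.V A.E (A.I l)
  /-- guards of input transitions do not depend on external variables -/
  input_guard : ∀ {l g a ρ l'}, A.tr l g a ρ l' →
    ((∃ δ, a = .brecv δ) ∨ ∃ c, a = .crecv c) → NotDependOn A.V A.E g
  /-- some transition is possible whenever the automaton is in a committed location -/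
  committed : ∀ l ∈ A.K, ∀ v ∈ A.I l, ∃ g a ρ l', A.tr l g a ρ l' ∧ v ∈ g ∧ ρ v ∈ A.I l'
  /-- urgent transitions are internal and have no clock guards -/
  urgent : ∀ {l g a ρ l'}, A.urgent l g a ρ l' →
    a = .tau ∧ NotDependOn A.V (A.V ∩ clocks X Y) g
  /-- broadcast input transitions do not update external variables -/
  recv_update : ∀ {l g δ ρ l'}, A.tr l g (.brecv δ) ρ l' →
    ∀ v ∈ (Val A.V : Set (PVal X D)), (ρ v).restrict A.E = v.restrict A.E

/-- Broadcast inputs lead to legal states (which makes `TTSB(A)` input-enabled for broadcast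
actions): if the guard of some `δ?`-transition holds in a legal state, then at least one `δ?`-transition
whose guard holds leads to a legal state. -/
def Receptive (A : TA X D Δ C) : Prop :=
  ∀ l, ∀ v ∈ A.I l, ∀ δ, (∃ g ρ l', A.tr l g (.brecv δ) ρ l' ∧ v ∈ g) →
    ∃ g ρ l', A.tr l g (.brecv δ) ρ l' ∧ v ∈ g ∧ ρ v ∈ A.I l'

end TA

/-! ### Timed transition systems with broadcast actions -/

/-- The tuples `⟨E, H, S, s⁰, Act, →¹, →⁰⟩`; `tr b` is the relation `→ᵇ`. The structure carries
only the data: it is used for the concrete tuples built below, and restriction by broadcast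
channels does not preserve input-enabledness. -/
structure TTSB (X : Type*) {Y : Type*} (D : Y → Type) (Δ C : Type*) where
  E : Set (Var X Y)
  H : Set (Var X Y)
  S : Set (PVal X D)
  s0 : PVal X D
  tr : Bool → PVal X D → Act Δ C → PVal X D → Prop

namespace TTSB

variable {X Y : Type*} {D : Y → Type} {Δ C : Type*}

/-- `s` is a committed state. -/
def Comm (T : TTSB X D Δ C) (s : PVal X D) : Prop := ∃ a t, T.tr true s a t

/-- The transitions of a parallel composition, with `T₁` in the role of component `i` and `T₂`
in the role of component `j` of the rules. -/
inductive ParStep (T₁ T₂ : TTSB X D Δ C) : Bool → PVal X D → Act Δ C → PVal X D → Prop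
  | ext {r s r' : PVal X D} {b : Bool} {a : DAct Δ C} :
      r ∈ T₁.S → s ∈ T₂.S → r.Compat s →
      ((∃ c, a = .csend c) ∨ ∃ c, a = .crecv c) →
      T₁.tr b r (.disc a) r' →
      ParStep T₁ T₂ b (r.override s) (.disc a) (r'.override s)
  | tau {r s r' : PVal X D} {b : Bool} :
      r ∈ T₁.S → s ∈ T₂.S → r.Compat s →
      T₁.tr b r (.disc .tau) r' → (T₂.Comm s → b = true) →
      ParStep T₁ T₂ b (r.override s) (.disc .tau) (r'.override s)
  | sync {r s r' s' : PVal X D} {b b' : Bool} {c : C} :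
      r ∈ T₁.S → s ∈ T₂.S → r.Compat s →
      T₁.tr b r (.disc (.csend c)) r' → T₂.tr b' (s.update r') (.disc (.crecv c)) s' →
      (T₁.Comm r ∨ T₂.Comm s → (b || b') = true) →
      ParStep T₁ T₂ (b || b') (r.override s) (.disc .tau) (s'.override r')
  | time {r s r' s' : PVal X D} {d : ℝ≥0} :
      r ∈ T₁.S → s ∈ T₂.S → r.Compat s →
      T₁.tr false r (.delay d) r' → T₂.tr false s (.delay d) s' → r'.Compat s' →
      ParStep T₁ T₂ false (r.override s) (.delay d) (r'.override s')
  | snd {r s r' s' : PVal X D} {b b' : Bool} {δ : Δ} :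
      r ∈ T₁.S → s ∈ T₂.S → r.Compat s →
      T₁.tr b r (.disc (.bsend δ)) r' → T₂.tr b' (s.update r') (.disc (.brecv δ)) s' →
      r'.Compat s' →
      ParStep T₁ T₂ (b || b') (r.override s) (.disc (.bsend δ)) (r'.override s')
  | rcv {r s r' s' : PVal X D} {b b' : Bool} {δ : Δ} :
      r ∈ T₁.S → s ∈ T₂.S → r.Compat s →
      T₁.tr b r (.disc (.brecv δ)) r' → T₂.tr b' s (.disc (.brecv δ)) s' →
      r'.Compat s' →
      ParStep T₁ T₂ (b || b') (r.override s) (.disc (.brecv δ)) (r'.override s')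

/-- The parallel composition `T₁ ‖ T₂` (used for compatible `T₁`, `T₂` only). -/
def par (T₁ T₂ : TTSB X D Δ C) : TTSB X D Δ C where
  E := T₁.E ∪ T₂.E
  H := T₁.H ∪ T₂.H
  S := {v | ∃ r ∈ T₁.S, ∃ s ∈ T₂.S, r.Compat s ∧ v = r.override s}
  s0 := T₁.s0.override T₂.s0
  tr := fun b u a u' => ParStep T₁ T₂ b u a u' ∨ ParStep T₂ T₁ b u a u'

/-- `T_0 ‖ ⋯ ‖ T_n`, bracketed to the left. -/
def parAll : {n : ℕ} → (Fin (n + 1) → TTSB X D Δ C) → TTSB X D Δ C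
  | 0, T => T 0
  | _ + 1, T => (parAll fun i => T i.castSucc).par (T (Fin.last _))

/-- The transitions of the restriction by the broadcast channels in `B` and the binary channels
in `F`: a transition that is kept, or a `τ`-transition that replaces a `δ!`-transition. -/
inductive RestrictStep (T : TTSB X D Δ C) (B : Set Δ) (F : Set C) :
    Bool → PVal X D → Act Δ C → PVal X D → Prop
  | keep {s t : PVal X D} {b : Bool} {a : Act Δ C} :
      T.tr b s a t →
      (∀ δ ∈ B, a ≠ .disc (.bsend δ) ∧ a ≠ .disc (.brecv δ)) →
      (∀ c ∈ F, a ≠ .disc (.csend c) ∧ a ≠ .disc (.crecv c)) →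
      RestrictStep T B F b s a t
  | hide {s t : PVal X D} {b : Bool} {δ : Δ} :
      δ ∈ B → T.tr b s (.disc (.bsend δ)) t → (T.Comm s → b = true) →
      RestrictStep T B F b s (.disc .tau) t

/-- The restriction of `T` by the set `B ∪ F ∪ Z` of broadcast channels, binary channels and
external variables (`Z ⊆ E`). -/
def restrict (T : TTSB X D Δ C) (B : Set Δ) (F : Set C) (Z : Set (Var X Y)) :
    TTSB X D Δ C where
  E := T.E \ Z
  H := T.H ∪ (T.E ∩ Z)
  S := T.S
  s0 := T.s0
  tr := RestrictStep T B F

/-- The underlying labeled transition system `LTS(T)`. -/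
def lts (T : TTSB X D Δ C) (h : T.s0 ∈ T.S) : LTS (Act Δ C) where
  State := T.S
  init := ⟨T.s0, h⟩
  tr := fun s a t => T.tr true s a t ∨ T.tr false s a t

end TTSB

/-! ### The TTSB of a timed automaton -/

namespace TA

variable {X Y : Type*} {D : Y → Type} {Δ C : Type*}

/-- The states of the TTSB associated to `A`. -/
def states (A : TA X D Δ C) : Set (PVal X D) :=
  {v | v ∈ (Val A.W : Set (PVal X D)) ∧ ∃ l, A.At v l ∧ Holds A.V (A.I l) v}

/-- The transitions of the TTSB associated to `A`. -/
inductive Step (A : TA X D Δ C) : Bool → PVal X D → Act Δ C → PVal X D → Prop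
  | act {s s' : PVal X D} {l g a ρ l'} {b : Bool} :
      s ∈ A.states → s' ∈ A.states →
      A.tr l g a ρ l' → A.At s l → Holds A.V g s →
      s' = (A.apply ρ s).update (A.locVal l') → (b = true ↔ l ∈ A.K) →
      Step A b s (.disc a) s'
  | time {s s' : PVal X D} {d : ℝ≥0} :
      s ∈ A.states → s' ∈ A.states →
      s' = s.delay d → ¬ A.InCommitted s →
      (¬ ∃ l g ρ l', A.urgent l g .tau ρ l' ∧ A.At s l ∧ Holds A.V g s) →
      Step A false s (.delay d) s'
  | virt {s : PVal X D} {δ : Δ} :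
      s ∈ A.states →
      (¬ ∃ l g ρ l', A.tr l g (.brecv δ) ρ l' ∧ A.At s l ∧ Holds A.V g s) →
      Step A false s (.disc (.brecv δ)) s

/-- `TTSB(A)`. -/
def ttsb (A : TA X D Δ C) : TTSB X D Δ C where
  E := A.E
  H := A.H ∪ {Var.data A.loc}
  S := A.states
  s0 := A.v0.override (A.locVal A.l0)
  tr := A.Step

end TA

/-! ### Networks of timed automata -/

/-- Networks `⟨A_0, …, A_n⟩` of pairwise compatible timed automata. -/
structure NTA (X : Type*) {Y : Type*} (D : Y → Type) (Δ C : Type*) (n : ℕ) where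
  A : Fin (n + 1) → TA X D Δ C
  compat : ∀ i j, i ≠ j → (A i).Compatible (A j)

namespace NTA

variable {X Y : Type*} {D : Y → Type} {Δ C : Type*} {n : ℕ}

/-- The states of `LTS(N)`. -/
def states (N : NTA X D Δ C n) : Set (PVal X D) :=
  {v | v ∈ (Val (⋃ i, (N.A i).W) : Set (PVal X D)) ∧
    ∀ i, ∃ l, (N.A i).At v l ∧ Holds (N.A i).V ((N.A i).I l) v}

/-- The initial state of `LTS(N)`. -/
def s0 (N : NTA X D Δ C n) : PVal X D :=
  (PVal.mergeAll fun i => (N.A i).v0).override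
    (PVal.mergeAll fun i => (N.A i).locVal (N.A i).l0)

/-- `RS(δ, i, s)`: the automata other than `A i` with an executable `δ?`-transition. -/
def RS (N : NTA X D Δ C n) (δ : Δ) (i : Fin (n + 1)) (s : PVal X D) : Set (Fin (n + 1)) :=
  {j | i ≠ j ∧ ∃ l g ρ l', (N.A j).tr l g (.brecv δ) ρ l' ∧ (N.A j).At s l ∧
    Holds (N.A j).V g s}

open Classical in
/-- `RS(δ, i, s)` enumerated as `j_1, …, j_m` in the order of the network. -/
def RSlist (N : NTA X D Δ C n) (δ : Δ) (i : Fin (n + 1)) (s : PVal X D) : List (Fin (n + 1)) :=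
  (List.finRange (n + 1)).filter fun j => j ∈ N.RS δ i s

/-- No automaton is in a committed location. -/
def NoCommitted (N : NTA X D Δ C n) (s : PVal X D) : Prop := ∀ k, ¬ (N.A k).InCommitted s

/-- The rules for the transitions of `LTS(N)`. In the rule for broadcasts, `l k`, `g k`, `ρ k`,
`l' k` describe the chosen transition of `A k`; they matter only for `k = i` and
`k ∈ RS(δ, i, s)`. -/
inductive Step (N : NTA X D Δ C n) : PVal X D → Act Δ C → PVal X D → Prop
  | tau {s s' : PVal X D} {i l g ρ l'} :
      (N.A i).tr l g .tau ρ l' → (N.A i).At s l → Holds (N.A i).V g s →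
      s' = ((N.A i).apply ρ s).update ((N.A i).locVal l') →
      (N.NoCommitted s ∨ l ∈ (N.A i).K) →
      Step N s (.disc .tau) s'
  | sync {s s' : PVal X D} {c : C} {i j li gi ρi li' lj gj ρj lj'} :
      i ≠ j →
      (N.A i).tr li gi (.csend c) ρi li' → (N.A i).At s li → Holds (N.A i).V gi s →
      (N.A j).tr lj gj (.crecv c) ρj lj' → (N.A j).At s lj → Holds (N.A j).V gj s →
      s' = ((N.A j).apply ρj ((N.A i).apply ρi s)).update
        (((N.A i).locVal li').override ((N.A j).locVal lj')) →
      (N.NoCommitted s ∨ li ∈ (N.A i).K ∨ lj ∈ (N.A j).K) →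
      Step N s (.disc .tau) s'
  | time {s s' : PVal X D} {d : ℝ≥0} :
      s' = s.delay d → N.NoCommitted s →
      (¬ ∃ i l g ρ l', (N.A i).urgent l g .tau ρ l' ∧ (N.A i).At s l ∧ Holds (N.A i).V g s) →
      Step N s (.delay d) s'
  | bcst {s s' : PVal X D} {δ : Δ} {i : Fin (n + 1)}
      {l l' : ∀ k, D (N.A k).loc} {g : Fin (n + 1) → Set (PVal X D)}
      {ρ : Fin (n + 1) → PVal X D → PVal X D} :
      (N.A i).tr (l i) (g i) (.bsend δ) (ρ i) (l' i) →
      (N.A i).At s (l i) → Holds (N.A i).V (g i) s →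
      (∀ j ∈ N.RS δ i s, (N.A j).tr (l j) (g j) (.brecv δ) (ρ j) (l' j) ∧
        (N.A j).At s (l j) ∧ Holds (N.A j).V (g j) s) →
      (N.NoCommitted s ∨ l i ∈ (N.A i).K ∨ ∃ j ∈ N.RS δ i s, l j ∈ (N.A j).K) →
      s' = ((N.RSlist δ i s).foldl (fun t j => (N.A j).apply (ρ j) t)
          ((N.A i).apply (ρ i) s)).update
        ((i :: N.RSlist δ i s).foldr (fun k f => ((N.A k).locVal (l' k)).override f)
          PVal.empty) →
      Step N s (.disc .tau) s'

/-- `(TTSB(A_0) ‖ ⋯ ‖ TTSB(A_n)) \ (Δ ∪ C)`. -/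
def ttsb (N : NTA X D Δ C n) : TTSB X D Δ C :=
  (TTSB.parAll fun i => (N.A i).ttsb).restrict Set.univ Set.univ ∅

end NTA

/-! ### The initial states are states -/

section Init

variable {X Y : Type*} {D : Y → Type} {Δ C : Type*} {n : ℕ}

theorem PVal.compat_iff {f g : PVal X D} :
    f.Compat g ↔ ∀ x a b, f x = some a → g x = some b → a = b := by
  constructor
  · intro h x a b ha hb
    have := h x ⟨by simp [PVal.dom, ha], by simp [PVal.dom, hb]⟩
    rw [ha, hb] at this
    exact Option.some.inj this
  · rintro h x ⟨h1, h2⟩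
    obtain ⟨a, ha⟩ := Option.isSome_iff_exists.1 h1
    obtain ⟨b, hb⟩ := Option.isSome_iff_exists.1 h2
    rw [ha, hb, h x a b ha hb]

theorem PVal.Compat.symm {f g : PVal X D} (h : f.Compat g) : g.Compat f :=
  fun x hx => (h x hx.symm).symm

theorem PVal.exists_of_mergeAll : ∀ {n : ℕ} {f : Fin (n + 1) → PVal X D} {x a},
    PVal.mergeAll f x = some a → ∃ i, f i x = some a
  | 0, f, x, a, h => ⟨0, h⟩
  | n + 1, f, x, a, h => by
    simp only [PVal.mergeAll, PVal.override, Option.or_eq_some_iff] at h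
    rcases h with h | ⟨-, h⟩
    · obtain ⟨i, hi⟩ := exists_of_mergeAll h
      exact ⟨_, hi⟩
    · exact ⟨_, h⟩

theorem PVal.mergeAll_of_some : ∀ {n : ℕ} {f : Fin (n + 1) → PVal X D},
    (∀ i j, (f i).Compat (f j)) → ∀ {i x a}, f i x = some a → PVal.mergeAll f x = some a
  | 0, f, _, i, x, a, h => by
    obtain rfl : i = 0 := Fin.fin_one_eq_zero i
    exact h
  | n + 1, f, hf, i, x, a, h => by
    simp only [PVal.mergeAll, PVal.override, Option.or_eq_some_iff]
    rcases hm : PVal.mergeAll (fun i => f i.castSucc) x with _ | b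
    · right
      refine ⟨rfl, ?_⟩
      induction i using Fin.lastCases with
      | last => exact h
      | cast i =>
        rw [mergeAll_of_some (fun i j => hf _ _) h] at hm
        cases hm
    · left
      obtain ⟨j, hj⟩ := exists_of_mergeAll hm
      rw [PVal.compat_iff.1 (hf _ _) x b a hj h]

theorem PVal.compat_refl (f : PVal X D) : f.Compat f := fun _ _ => rfl

theorem PVal.single_some {y : Y} {l : D y} {x : Var X Y} {a : x.Dom D} :
    (PVal.single y l : PVal X D) x = some a → x = Var.data y := by
  cases x with
  | clock x => exact fun h => nomatch h
  | data z =>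
    simp only [PVal.single]
    split
    · next h => exact fun _ => h ▸ rfl
    · simp

theorem PVal.single_self (y : Y) (l : D y) :
    (PVal.single y l : PVal X D) (Var.data y) = some l :=
  dif_pos rfl

theorem PVal.single_dom {y : Y} {l : D y} : (PVal.single y l : PVal X D).dom = {Var.data y} := by
  ext x
  constructor
  · intro h
    obtain ⟨a, ha⟩ := Option.isSome_iff_exists.1 h
    exact PVal.single_some ha
  · rintro rfl
    exact Option.isSome_iff_exists.2 ⟨l, PVal.single_self y l⟩

theorem PVal.override_dom (f g : PVal X D) : (f.override g).dom = f.dom ∪ g.dom := by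
  ext x; simp [PVal.dom, PVal.override]

theorem PVal.mergeAll_dom : ∀ {n : ℕ} (f : Fin (n + 1) → PVal X D),
    (PVal.mergeAll f).dom = ⋃ i, (f i).dom
  | 0, f => by ext x; simp [PVal.mergeAll, Fin.exists_fin_one]
  | n + 1, f => by
    ext x
    simp only [PVal.mergeAll, PVal.override_dom, mergeAll_dom, Set.mem_union, Set.mem_iUnion,
      Fin.exists_fin_succ']

theorem PVal.override_of_notMem {f g : PVal X D} {x} (h : x ∉ f.dom) :
    f.override g x = g x := by
  have : f x = none := by simpa [PVal.dom] using h
  simp [PVal.override, this]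

theorem PVal.override_of_some {f g : PVal X D} {x a} (h : f x = some a) :
    f.override g x = some a := by
  simp [PVal.override, h]

theorem PVal.restrict_eq {f v : PVal X D} (h : ∀ x a, v x = some a → f x = some a) :
    f.restrict v.dom = v := by
  funext x
  by_cases hx : x ∈ v.dom
  · obtain ⟨a, ha⟩ := Option.isSome_iff_exists.1 hx
    simp [PVal.restrict, hx, ha, h x a ha]
  · have : v x = none := by simpa [PVal.dom] using hx
    simp [PVal.restrict, hx, this]

theorem TTSB.parAll_s0 : ∀ {n : ℕ} (T : Fin (n + 1) → TTSB X D Δ C),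
    (TTSB.parAll T).s0 = PVal.mergeAll fun i => (T i).s0
  | 0, _ => rfl
  | n + 1, T => by simp [TTSB.parAll, TTSB.par, PVal.mergeAll, parAll_s0]

theorem TTSB.parAll_s0_mem : ∀ {n : ℕ} (T : Fin (n + 1) → TTSB X D Δ C),
    (∀ i, (T i).s0 ∈ (T i).S) → (∀ i j, (T i).s0.Compat (T j).s0) →
    (TTSB.parAll T).s0 ∈ (TTSB.parAll T).S
  | 0, T, h, _ => h 0
  | n + 1, T, h, hc => by
    refine ⟨_, parAll_s0_mem _ (fun i => h _) (fun i j => hc _ _), _, h _, ?_, rfl⟩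
    rw [TTSB.parAll_s0, PVal.compat_iff]
    intro x a b ha hb
    obtain ⟨i, hi⟩ := PVal.exists_of_mergeAll ha
    exact PVal.compat_iff.1 (hc _ _) x a b hi hb

theorem TA.ttsb_s0_mem (A : TA X D Δ C) : A.ttsb.s0 ∈ A.ttsb.S := by
  have hv : A.v0.dom = A.E ∪ A.H := A.v0_mem
  refine ⟨?_, A.l0, ?_, ?_⟩
  · change PVal.dom _ = _
    simp [TA.ttsb, PVal.override_dom, TA.locVal, PVal.single_dom, TA.W, hv]
  · exact (PVal.override_of_notMem (by rw [hv]; exact A.loc_fresh)).trans (PVal.single_self _ _)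
  · have : (A.ttsb.s0).restrict A.v0.dom = A.v0 :=
      PVal.restrict_eq fun x a h => PVal.override_of_some h
    rw [hv] at this
    change PVal.restrict _ _ ∈ _
    rw [TA.V, this]
    exact A.v0_inv

theorem NTA.ttsb_s0_mem (N : NTA X D Δ C n) : N.ttsb.s0 ∈ N.ttsb.S := by
  refine TTSB.parAll_s0_mem _ (fun i => (N.A i).ttsb_s0_mem) fun i j => ?_
  rcases eq_or_ne i j with rfl | hij
  · exact PVal.compat_refl _
  have h := N.compat i j hij
  have hi : (N.A i).v0.dom = (N.A i).V := (N.A i).v0_mem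
  have hj : (N.A j).v0.dom = (N.A j).V := (N.A j).v0_mem
  rw [PVal.compat_iff]
  intro x a b ha hb
  simp only [TA.ttsb, TA.locVal, PVal.override, Option.or_eq_some_iff] at ha hb
  have mem : ∀ {f : PVal X D} {a}, f x = some a → x ∈ f.dom := fun h => by simp [PVal.dom, h]
  rcases ha with ha | ⟨-, ha⟩ <;> rcases hb with hb | ⟨-, hb⟩
  · exact PVal.compat_iff.1 h.init x a b ha hb
  · obtain rfl := PVal.single_some hb
    exact absurd (hi ▸ mem ha) h.loc_right
  · obtain rfl := PVal.single_some ha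
    exact absurd (hj ▸ mem hb) h.loc_left
  · obtain rfl := PVal.single_some ha
    have h' := PVal.single_some hb
    exact absurd (Var.data.inj h') h.loc_ne

theorem NTA.s0_mem (N : NTA X D Δ C n) : N.s0 ∈ N.states := by
  have hv : ∀ i, (N.A i).v0.dom = (N.A i).V := fun i => (N.A i).v0_mem
  have hc : ∀ i j, ((N.A i).v0).Compat (N.A j).v0 := fun i j => by
    rcases eq_or_ne i j with rfl | hij
    · exact PVal.compat_refl _
    · exact (N.compat i j hij).init
  have hl : ∀ i j, ((N.A i).locVal (N.A i).l0).Compat ((N.A j).locVal (N.A j).l0) := fun i j => by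
    rcases eq_or_ne i j with rfl | hij
    · exact PVal.compat_refl _
    · rw [PVal.compat_iff]
      intro x a b ha hb
      obtain rfl := PVal.single_some ha
      have h' := PVal.single_some hb
      exact absurd (Var.data.inj h') (N.compat i j hij).loc_ne
  refine ⟨?_, fun i => ⟨(N.A i).l0, ?_, ?_⟩⟩
  · change PVal.dom _ = _
    simp only [NTA.s0, PVal.override_dom, PVal.mergeAll_dom, hv, TA.locVal, PVal.single_dom, TA.W,
      TA.V, Set.iUnion_union_distrib]
  · refine (PVal.override_of_notMem ?_).trans
      (PVal.mergeAll_of_some hl (i := i) (PVal.single_self _ _))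
    rw [PVal.mergeAll_dom, Set.mem_iUnion]
    rintro ⟨j, hj⟩
    rw [hv] at hj
    rcases eq_or_ne i j with rfl | hij
    · exact (N.A i).loc_fresh hj
    · exact (N.compat i j hij).loc_left hj
  · have : (N.s0).restrict (N.A i).v0.dom = (N.A i).v0 :=
      PVal.restrict_eq fun x a h => PVal.override_of_some (PVal.mergeAll_of_some hc h)
    rw [hv] at this
    change PVal.restrict _ _ ∈ _
    rw [this]
    exact (N.A i).v0_inv

end Init

namespace NTA

variable {X Y : Type*} {D : Y → Type} {Δ C : Type*} {n : ℕ}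

/-- The non-compositional semantics `LTS(N)`. -/
def lts (N : NTA X D Δ C n) : LTS (Act Δ C) where
  State := N.states
  init := ⟨N.s0, N.s0_mem⟩
  tr := fun s a t => N.Step s a t

/-- The compositional semantics `LTS((TTSB(A_0) ‖ ⋯ ‖ TTSB(A_n)) \ (Δ ∪ C))`. -/
def compLts (N : NTA X D Δ C n) : LTS (Act Δ C) := N.ttsb.lts N.ttsb_s0_mem

end NTA

end BroadcastTA

end

open BroadcastTA

/-!
The composition of the TTSBs of any set of components is again a transition system on the valuations
of the variables of these components, and its discrete transitions are sequential compositions of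
transitions of single components, each of which leaves the variables of all other components alone
except for shared external ones. Three facts make this independent of the bracketing. Broadcast
inputs do not update external variables, so the receivers of a broadcast do not interfere with each
other and may be ordered arbitrarily. Invariants and input guards do not depend on external
variables, so legality of a component and the set of enabled receivers are the same before and after
another component has moved. Committed locations can always be left and broadcasts can always be
received, so a state of a composition has a committed transition if and only if some component is in
a committed location. By induction on the number of components, the full composition therefore has
the transitions prescribed by the non-compositional rules.
-/

namespace BroadcastTA

/-! ### Partial valuations -/

namespace PVal

variable {X Y : Type*} {D : Y → Type} {f g h v : PVal X D} {x : Var X Y} {Z W : Set (Var X Y)}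

theorem notMem_dom : x ∉ f.dom ↔ f x = none := by
  simp [dom]

theorem mem_dom_congr (hfg : f x = g x) : x ∈ f.dom ↔ x ∈ g.dom := by
  simp [dom, hfg]

theorem restrict_of_mem (hx : x ∈ Z) : f.restrict Z x = f x := if_pos hx

theorem restrict_of_notMem (hx : x ∉ Z) : f.restrict Z x = none := if_neg hx

theorem restrict_dom (f : PVal X D) (Z : Set (Var X Y)) : (f.restrict Z).dom = f.dom ∩ Z := by
  ext x
  by_cases hx : x ∈ Z <;> simp [dom, restrict, hx]

theorem restrict_dom_of_subset (hZ : Z ⊆ f.dom) : (f.restrict Z).dom = Z := by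
  rw [restrict_dom, Set.inter_eq_right.2 hZ]

theorem restrict_congr (hfg : ∀ x ∈ Z, f x = g x) : f.restrict Z = g.restrict Z := by
  funext x
  by_cases hx : x ∈ Z
  · rw [restrict_of_mem hx, restrict_of_mem hx, hfg x hx]
  · rw [restrict_of_notMem hx, restrict_of_notMem hx]

theorem eq_of_restrict_eq (hfg : f.restrict Z = g.restrict Z) (hx : x ∈ Z) : f x = g x := by
  rw [← restrict_of_mem (f := f) hx, hfg, restrict_of_mem hx]

theorem restrict_self (hf : f.dom = Z) : f.restrict Z = f := by
  subst hf
  exact restrict_eq fun _ _ h => h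

theorem override_of_mem (hx : x ∈ f.dom) : f.override g x = f x := by
  obtain ⟨a, ha⟩ := Option.isSome_iff_exists.1 hx
  rw [override_of_some ha, ha]

theorem override_assoc (f g h : PVal X D) :
    (f.override g).override h = f.override (g.override h) := by
  funext x
  exact Option.or_assoc

theorem override_empty (f : PVal X D) : f.override empty = f := by
  funext x
  exact Option.or_none

theorem Compat.override_comm (hfg : f.Compat g) : f.override g = g.override f := by
  funext x
  by_cases hf : x ∈ f.dom
  · by_cases hg : x ∈ g.dom
    · rw [override_of_mem hf, override_of_mem hg, hfg x ⟨hf, hg⟩]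
    · rw [override_of_mem hf, override_of_notMem hg]
  · rw [override_of_notMem hf]
    by_cases hg : x ∈ g.dom
    · rw [override_of_mem hg]
    · rw [override_of_notMem hg, notMem_dom.1 hf, notMem_dom.1 hg]

theorem compat_of_disjoint (hfg : Disjoint f.dom g.dom) : f.Compat g :=
  fun _ hx => (Set.disjoint_left.1 hfg hx.1 hx.2).elim

theorem compat_restrict_restrict (v : PVal X D) (Z W : Set (Var X Y)) :
    (v.restrict Z).Compat (v.restrict W) := by
  rintro x ⟨hZ, hW⟩
  rw [restrict_dom] at hZ hW
  rw [restrict_of_mem hZ.2, restrict_of_mem hW.2]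

theorem restrict_override_restrict (hv : v.dom ⊆ Z ∪ W) (hfv : ∀ x ∉ Z, f x = v x)
    (hZ : Z ⊆ f.dom) : (f.restrict Z).override (v.restrict W) = f := by
  funext x
  by_cases hx : x ∈ Z
  · rw [override_of_mem (by rwa [restrict_dom_of_subset hZ]), restrict_of_mem hx]
  · rw [override_of_notMem (notMem_dom.2 (restrict_of_notMem hx)), hfv x hx]
    by_cases hW : x ∈ W
    · exact restrict_of_mem hW
    · rw [restrict_of_notMem hW, eq_comm, ← notMem_dom]
      exact fun hxv => (hv hxv).elim hx hW

theorem update_of_mem (hf : x ∈ f.dom) (hg : x ∈ g.dom) : f.update g x = g x := by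
  rw [update, restrict_of_mem hf, override_of_mem hg]

theorem update_of_notMem (hg : x ∉ g.dom) : f.update g x = f x := by
  by_cases hf : x ∈ f.dom
  · rw [update, restrict_of_mem hf, override_of_notMem hg]
  · rw [update, restrict_of_notMem hf, notMem_dom.1 hf]

theorem update_dom (f g : PVal X D) : (f.update g).dom = f.dom := by
  rw [update, restrict_dom, override_dom, Set.inter_eq_right]
  exact Set.subset_union_right

theorem update_update (f g h : PVal X D) : (f.update g).update h = f.update (h.override g) := by
  rw [update, update_dom, update, restrict_congr (g := (h.override g).override f), ← update]
  intro x hx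
  rw [override_assoc, override, override, restrict_of_mem hx]

theorem update_override (f g : PVal X D) : (f.update g).override g = g.override f := by
  funext x
  by_cases hf : x ∈ f.dom
  · rw [override_of_mem (by rwa [update_dom]), update, restrict_of_mem hf]
  · rw [override_of_notMem (by rwa [update_dom]), override, notMem_dom.1 hf, Option.or_none]

theorem delay_dom (f : PVal X D) (d : ℝ≥0) : (f.delay d).dom = f.dom := by
  ext x
  cases x <;> simp [dom, delay]

theorem delay_override (f g : PVal X D) (d : ℝ≥0) :
    (f.override g).delay d = (f.delay d).override (g.delay d) := by
  funext x
  cases x with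
  | clock x => simp only [delay, override]; cases f (.clock x) <;> rfl
  | data y => rfl

theorem delay_congr {d : ℝ≥0} (hfg : f x = g x) : f.delay d x = g.delay d x := by
  cases x with
  | clock x => simp only [delay, hfg]
  | data y => exact hfg

theorem restrict_delay (f : PVal X D) (Z : Set (Var X Y)) (d : ℝ≥0) :
    (f.restrict Z).delay d = (f.delay d).restrict Z := by
  funext x
  by_cases hx : x ∈ Z
  · rw [restrict_of_mem hx]
    exact delay_congr (restrict_of_mem hx)
  · rw [restrict_of_notMem hx, ← notMem_dom, delay_dom, notMem_dom, restrict_of_notMem hx]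

theorem mergeAll_override : ∀ {n : ℕ} (f g : Fin (n + 1) → PVal X D),
    (Pairwise fun i j => Disjoint (g i).dom (f j).dom) →
    (mergeAll fun i => (f i).override (g i)) = (mergeAll f).override (mergeAll g)
  | 0, _, _, _ => rfl
  | n + 1, f, g, hfg => by
    have hlast : Disjoint (mergeAll fun i : Fin (n + 1) => g i.castSucc).dom
        (f (Fin.last _)).dom := by
      rw [mergeAll_dom, Set.disjoint_iUnion_left]
      exact fun i => hfg (Fin.castSucc_lt_last i).ne
    simp only [mergeAll]
    rw [mergeAll_override _ _ fun i j hij => hfg ((Fin.castSucc_injective _).ne hij),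
      override_assoc, ← override_assoc (mergeAll fun i : Fin (n + 1) => g i.castSucc),
      (compat_of_disjoint hlast).override_comm, override_assoc, override_assoc]

end PVal

variable {X Y : Type*} {D : Y → Type} {Δ C : Type*}

theorem holds_congr {V : Set (Var X Y)} {P : Set (PVal X D)} {s t : PVal X D}
    (hst : ∀ x ∈ V, s x = t x) : Holds V P s ↔ Holds V P t := by
  rw [Holds, Holds, PVal.restrict_congr hst]

theorem holds_restrict_of_subset {V W : Set (Var X Y)} (hVW : V ⊆ W) {P : Set (PVal X D)}
    {s : PVal X D} : Holds V P (s.restrict W) ↔ Holds V P s :=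
  holds_congr fun _ hx => PVal.restrict_of_mem (hVW hx)

theorem NotDependOn.holds_iff {V E : Set (Var X Y)} {P : Set (PVal X D)} (hP : NotDependOn V E P)
    (hE : E ⊆ V) {s t : PVal X D} (hs : V ⊆ s.dom) (ht : V ⊆ t.dom)
    (hst : ∀ x ∈ V, x ∉ E → s x = t x) : Holds V P s ↔ Holds V P t := by
  have hdom := PVal.restrict_dom_of_subset hs
  have hdomE := PVal.restrict_dom_of_subset (hE.trans ht)
  have hupdate : (s.restrict V).update (t.restrict E) = t.restrict V := by
    funext x
    by_cases hx : x ∈ V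
    · by_cases hxE : x ∈ E
      · rw [PVal.update_of_mem (by rwa [hdom]) (by rwa [hdomE]), PVal.restrict_of_mem hxE,
          PVal.restrict_of_mem hx]
      · rw [PVal.update_of_notMem (by rwa [hdomE]), PVal.restrict_of_mem hx,
          PVal.restrict_of_mem hx, hst x hx hxE]
    · rw [PVal.restrict_of_notMem hx, ← PVal.notMem_dom, PVal.update_dom, hdom]
      exact hx
  rw [Holds, hP _ hdom _ hdomE, hupdate, Holds]

/-! ### Single automata -/

namespace TA

variable {A B : TA X D Δ C} {a : DAct Δ C} {l l' : D A.loc} {g : Set (PVal X D)}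
  {ρ : PVal X D → PVal X D} {s t : PVal X D} {x : Var X Y}

theorem V_subset_W : A.V ⊆ A.W := Set.subset_union_left

theorem E_subset_V : A.E ⊆ A.V := Set.subset_union_left

theorem E_subset_W : A.E ⊆ A.W := E_subset_V.trans V_subset_W

theorem loc_mem_W : Var.data A.loc ∈ A.W := Or.inr rfl

theorem loc_notMem_E : Var.data A.loc ∉ A.E := fun h => A.loc_fresh (E_subset_V h)

theorem locVal_dom (l : D A.loc) : (A.locVal l).dom = {Var.data A.loc} := PVal.single_dom

theorem Compatible.mem_E (hAB : A.Compatible B) (hA : x ∈ A.W) (hB : x ∈ B.W) : x ∈ A.E := by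
  rcases hA with hA | rfl
  · rcases hB with hB | rfl
    · exact hA.resolve_right fun hH => Set.eq_empty_iff_forall_notMem.1 hAB.left x ⟨hH, hB⟩
    · exact absurd hA hAB.loc_right
  · rcases hB with hB | hB
    · exact absurd hB hAB.loc_left
    · exact absurd (Var.data.inj hB) hAB.loc_ne

theorem Compatible.loc_notMem_W (hAB : A.Compatible B) : Var.data A.loc ∉ B.W :=
  fun h => loc_notMem_E (hAB.mem_E loc_mem_W h)

theorem At.unique (h : A.At s l) (h' : A.At s l') : l = l' := Option.some.inj (h.symm.trans h')

theorem At.inCommitted_iff (h : A.At s l) : A.InCommitted s ↔ l ∈ A.K :=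
  ⟨fun ⟨_, hk, hsk⟩ => h.unique hsk ▸ hk, fun hl => ⟨l, hl, h⟩⟩

theorem at_restrict : A.At (s.restrict A.W) l ↔ A.At s l := by
  rw [At, At, PVal.restrict_of_mem loc_mem_W]

theorem inCommitted_restrict : A.InCommitted (s.restrict A.W) ↔ A.InCommitted s := by
  simp only [InCommitted, at_restrict]

theorem inCommitted_congr (hst : s (Var.data A.loc) = t (Var.data A.loc)) :
    A.InCommitted s ↔ A.InCommitted t := by
  simp only [InCommitted, At, hst]

/-- The part of `s` that belongs to `A` is a state of `TTSB(A)`. -/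
def Legal (A : TA X D Δ C) (s : PVal X D) : Prop := s.restrict A.W ∈ A.states

theorem Legal.subset_dom (h : A.Legal s) : A.W ⊆ s.dom := by
  have hdom : (s.restrict A.W).dom = A.W := h.1
  rwa [PVal.restrict_dom, Set.inter_eq_right] at hdom

theorem legal_iff (hs : A.W ⊆ s.dom) : A.Legal s ↔ ∃ l, A.At s l ∧ Holds A.V (A.I l) s := by
  simp only [Legal, states, Set.mem_ofPred_eq, at_restrict, holds_restrict_of_subset V_subset_W,
    and_iff_right_iff_imp]
  exact fun _ => PVal.restrict_dom_of_subset hs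

theorem legal_congr (hst : ∀ x ∈ A.W, s x = t x) : A.Legal s ↔ A.Legal t := by
  rw [Legal, Legal, PVal.restrict_congr hst]

theorem mem_states_iff : s ∈ A.states ↔ s.dom = A.W ∧ A.Legal s :=
  ⟨fun hs => ⟨hs.1, by rwa [Legal, PVal.restrict_self hs.1]⟩,
    fun ⟨hdom, hs⟩ => by rwa [Legal, PVal.restrict_self hdom] at hs⟩

/-- The transition `A.tr l g a ρ l'` can be taken in `s`, up to legality of its target. -/
def Enabled (A : TA X D Δ C) (s : PVal X D) (l : D A.loc) (g : Set (PVal X D)) (a : DAct Δ C)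
    (ρ : PVal X D → PVal X D) (l' : D A.loc) : Prop :=
  A.tr l g a ρ l' ∧ A.At s l ∧ Holds A.V g s

theorem enabled_restrict : A.Enabled (s.restrict A.W) l g a ρ l' ↔ A.Enabled s l g a ρ l' := by
  rw [Enabled, Enabled, at_restrict, holds_restrict_of_subset V_subset_W]

/-- Some `δ?`-transition of `A` is enabled in `s`. Otherwise the only `δ?`-transition of `TTSB(A)`
from `s` is the virtual one. -/
def CanReceive (A : TA X D Δ C) (δ : Δ) (s : PVal X D) : Prop :=
  ∃ l g ρ l', A.Enabled s l g (.brecv δ) ρ l'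

theorem canReceive_restrict {δ : Δ} : A.CanReceive δ (s.restrict A.W) ↔ A.CanReceive δ s := by
  simp only [CanReceive, enabled_restrict]

/-- The valuation reached from `s` by a transition with update function `ρ` and target location
`l'`. -/
noncomputable def post (A : TA X D Δ C) (ρ : PVal X D → PVal X D) (l' : D A.loc)
    (s : PVal X D) : PVal X D :=
  (A.apply ρ s).update (A.locVal l')

theorem apply_dom (ρ : PVal X D → PVal X D) (s : PVal X D) : (A.apply ρ s).dom = s.dom :=
  PVal.update_dom _ _

theorem post_dom (ρ : PVal X D → PVal X D) (l' : D A.loc) (s : PVal X D) :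
    (A.post ρ l' s).dom = s.dom := by
  rw [post, PVal.update_dom, apply_dom]

theorem dom_update_of_tr (h : A.tr l g a ρ l') (hs : A.V ⊆ s.dom) :
    (ρ (s.restrict A.V)).dom = A.V :=
  A.tr_update h (PVal.restrict_dom_of_subset hs)

theorem post_loc (ρ : PVal X D → PVal X D) (l' : D A.loc) (hs : A.W ⊆ s.dom) :
    A.At (A.post ρ l' s) l' := by
  rw [At, post, PVal.update_of_mem, locVal, PVal.single_self]
  · rw [apply_dom]
    exact hs loc_mem_W
  · rw [locVal_dom]
    rfl

theorem post_of_ne_loc (hx : x ≠ Var.data A.loc) : A.post ρ l' s x = A.apply ρ s x := by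
  rw [post, PVal.update_of_notMem]
  rwa [locVal_dom]

theorem post_of_mem_V (h : A.tr l g a ρ l') (hs : A.W ⊆ s.dom) (hx : x ∈ A.V) :
    A.post ρ l' s x = ρ (s.restrict A.V) x := by
  rw [post_of_ne_loc (ne_of_mem_of_not_mem hx A.loc_fresh), apply,
    PVal.update_of_mem (hs (V_subset_W hx))]
  rwa [dom_update_of_tr h (V_subset_W.trans hs)]

theorem post_of_notMem_W (h : A.tr l g a ρ l') (hs : A.W ⊆ s.dom) (hx : x ∉ A.W) :
    A.post ρ l' s x = s x := by
  rw [post_of_ne_loc (ne_of_mem_of_not_mem loc_mem_W hx).symm, apply, PVal.update_of_notMem]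
  rw [dom_update_of_tr h (V_subset_W.trans hs)]
  exact fun hV => hx (V_subset_W hV)

theorem post_congr (h : A.tr l g a ρ l') (hs : A.W ⊆ s.dom) (ht : A.W ⊆ t.dom)
    (hst : ∀ x ∈ A.W, s x = t x) (hx : x ∈ A.W) : A.post ρ l' s x = A.post ρ l' t x := by
  rcases hx with hx | rfl
  · rw [post_of_mem_V h hs hx, post_of_mem_V h ht hx,
      PVal.restrict_congr fun x hx => hst x (V_subset_W hx)]
  · exact (post_loc _ _ hs).trans (post_loc _ _ ht).symm

theorem post_restrict (h : A.tr l g a ρ l') (hs : A.W ⊆ s.dom) :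
    A.post ρ l' (s.restrict A.W) = (A.post ρ l' s).restrict A.W := by
  have hdom := PVal.restrict_dom_of_subset hs
  rw [← PVal.restrict_self ((post_dom ρ l' _).trans hdom)]
  exact PVal.restrict_congr fun x hx =>
    post_congr h hdom.ge hs (fun y hy => PVal.restrict_of_mem hy) hx

theorem legal_post (h : A.tr l g a ρ l') (hs : A.W ⊆ s.dom) (hI : ρ (s.restrict A.V) ∈ A.I l') :
    A.Legal (A.post ρ l' s) := by
  refine (legal_iff (by rwa [post_dom])).2 ⟨l', post_loc _ _ hs, ?_⟩
  rwa [Holds, PVal.restrict_congr fun x hx => post_of_mem_V h hs hx,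
    PVal.restrict_self (dom_update_of_tr h (V_subset_W.trans hs))]

theorem apply_update (h : A.tr l g a ρ l') (hs : A.V ⊆ s.dom) {f : PVal X D}
    (hf : Disjoint f.dom A.V) : A.apply ρ (s.update f) = (A.apply ρ s).update f := by
  have hV : (s.update f).restrict A.V = s.restrict A.V :=
    PVal.restrict_congr fun x hx => PVal.update_of_notMem (Set.disjoint_right.1 hf hx)
  have hdisj : Disjoint f.dom (ρ (s.restrict A.V)).dom := by rwa [dom_update_of_tr h hs]
  rw [apply, apply, hV, PVal.update_update, PVal.update_update,
    (PVal.compat_of_disjoint hdisj).override_comm]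

theorem update_override_locVal (h : A.tr l g a ρ l') (hs : A.V ⊆ s.dom) {f : PVal X D}
    (hf : Disjoint f.dom A.W) :
    (A.apply ρ s).update (f.override (A.locVal l')) = A.post ρ l' (s.update f) := by
  have hloc : Disjoint f.dom (A.locVal l').dom := by
    rw [locVal_dom]
    exact hf.mono_right Set.subset_union_right
  rw [post, apply_update h hs (hf.mono_right V_subset_W), PVal.update_update,
    (PVal.compat_of_disjoint hloc).override_comm]

/-! ### Local and framed transitions -/

/-- A transition of `TTSB(A)` between the parts of `v` and `v'` that belong to `A`. -/
def LocalStep (A : TA X D Δ C) (b : Bool) (v : PVal X D) (a : Act Δ C) (v' : PVal X D) : Prop :=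
  A.Step b (v.restrict A.W) a (v'.restrict A.W)

/-- A discrete transition of `TTSB(A)` inside larger valuations, which leaves all variables that do
not belong to `A` unchanged. -/
def FrameStep (A : TA X D Δ C) (b : Bool) (v : PVal X D) (a : DAct Δ C) (v' : PVal X D) : Prop :=
  A.LocalStep b v (.disc a) v' ∧ ∀ x ∉ A.W, v' x = v x

variable {b : Bool} {α : Act Δ C} {δ : Δ} {u u' v v' w : PVal X D}

theorem Step.source_mem (h : A.Step b s α t) : s ∈ A.states := by
  cases h <;> assumption

theorem Step.target_mem (h : A.Step b s α t) : t ∈ A.states := by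
  cases h <;> assumption

theorem LocalStep.legal_source (h : A.LocalStep b v α v') : A.Legal v := Step.source_mem h

theorem LocalStep.legal_target (h : A.LocalStep b v α v') : A.Legal v' := Step.target_mem h

theorem localStep_congr (huv : ∀ x ∈ A.W, u x = v x) (huv' : ∀ x ∈ A.W, u' x = v' x) :
    A.LocalStep b u α u' ↔ A.LocalStep b v α v' := by
  rw [LocalStep, LocalStep, PVal.restrict_congr huv, PVal.restrict_congr huv']

theorem localStep_delay_congr {d : ℝ≥0} (huv : ∀ x ∈ A.W, u x = v x) :
    A.LocalStep b u (.delay d) (u.delay d) ↔ A.LocalStep b v (.delay d) (v.delay d) :=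
  localStep_congr huv fun x hx => PVal.delay_congr (huv x hx)

theorem localStep_iff_step (hv : v.dom = A.W) (hv' : v'.dom = A.W) :
    A.LocalStep b v α v' ↔ A.Step b v α v' := by
  rw [LocalStep, PVal.restrict_self hv, PVal.restrict_self hv']

theorem localStep_delay_iff {d : ℝ≥0} :
    A.LocalStep b v (.delay d) (v.delay d) ↔ b = false ∧ A.Legal v ∧ A.Legal (v.delay d) ∧
      ¬ A.InCommitted v ∧
      ¬ ∃ l g ρ l', A.urgent l g .tau ρ l' ∧ A.At v l ∧ Holds A.V g v := by
  constructor
  · intro h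
    have hlegal := h.legal_target
    rw [LocalStep] at h
    generalize (v.delay d).restrict A.W = t at h
    cases h with
    | time hv _ _ hK hurgent =>
      simp only [at_restrict, holds_restrict_of_subset V_subset_W, inCommitted_restrict]
        at hK hurgent
      exact ⟨rfl, hv, hlegal, hK, hurgent⟩
  · rintro ⟨rfl, hv, hv', hK, hurgent⟩
    refine .time hv hv' (PVal.restrict_delay _ _ _).symm (inCommitted_restrict.not.2 hK) ?_
    simpa only [at_restrict, holds_restrict_of_subset V_subset_W] using hurgent

theorem Enabled.localStep (h : A.Enabled v l g a ρ l') (hb : b = true ↔ l ∈ A.K)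
    (hv : A.Legal v) (hv' : A.Legal v') (hpost : ∀ x ∈ A.W, v' x = A.post ρ l' v x) :
    A.LocalStep b v (.disc a) v' := by
  obtain ⟨htr, hl, hg⟩ := enabled_restrict.2 h
  refine .act hv hv' htr hl hg ?_ hb
  rw [PVal.restrict_congr hpost, ← post_restrict htr hv.subset_dom, post]

theorem Enabled.frameStep (h : A.Enabled v l g a ρ l') (hb : b = true ↔ l ∈ A.K)
    (hv : A.Legal v) (hpost : A.Legal (A.post ρ l' v)) : A.FrameStep b v a (A.post ρ l' v) :=
  ⟨h.localStep hb hv hpost fun _ _ => rfl, fun _ hx => post_of_notMem_W h.1 hv.subset_dom hx⟩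

theorem localStep_of_not_canReceive (h : ¬ A.CanReceive δ v) (hv : A.Legal v)
    (hvv' : ∀ x ∈ A.W, v' x = v x) : A.LocalStep false v (.disc (.brecv δ)) v' := by
  rw [LocalStep, PVal.restrict_congr hvv']
  exact .virt hv (canReceive_restrict.not.2 h)

theorem LocalStep.disc_cases (h : A.LocalStep b v (.disc a) v') :
    (∃ l g ρ l', A.Enabled v l g a ρ l' ∧ (b = true ↔ l ∈ A.K) ∧
      ∀ x ∈ A.W, v' x = A.post ρ l' v x) ∨
    ∃ δ, a = .brecv δ ∧ ¬ A.CanReceive δ v ∧ b = false ∧ ∀ x ∈ A.W, v' x = v x := by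
  have hd := h.legal_source.subset_dom
  rw [LocalStep] at h
  generalize hs' : v'.restrict A.W = s' at h
  cases h with
  | act _ _ htr hl hg hpost hb =>
    rw [← post, post_restrict htr hd, ← hs'] at hpost
    exact .inl ⟨_, _, _, _, enabled_restrict.1 ⟨htr, hl, hg⟩, hb,
      fun x hx => PVal.eq_of_restrict_eq hpost hx⟩
  | virt _ hn =>
    exact .inr ⟨_, rfl, canReceive_restrict.not.1 hn, rfl,
      fun x hx => PVal.eq_of_restrict_eq hs' hx⟩

theorem LocalStep.flag_iff (h : A.LocalStep b v (.disc a) v') :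
    b = true ↔ A.InCommitted v ∧ ∀ δ, a = .brecv δ → A.CanReceive δ v := by
  rcases h.disc_cases with ⟨l, g, ρ, l', hen, hb, -⟩ | ⟨δ, rfl, hn, rfl, -⟩
  · rw [hb, hen.2.1.inCommitted_iff]
    refine (and_iff_left ?_).symm
    rintro δ rfl
    exact ⟨l, g, ρ, l', hen⟩
  · simpa using fun _ => hn

theorem LocalStep.flag_unique {b' : Bool} {v'' : PVal X D} (h : A.LocalStep b v (.disc a) v')
    (h' : A.LocalStep b' v (.disc a) v'') : b = b' := by
  rw [Bool.eq_iff_iff, h.flag_iff, h'.flag_iff]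

theorem LocalStep.inCommitted (h : A.LocalStep true v (.disc a) v') : A.InCommitted v :=
  (h.flag_iff.1 rfl).1

theorem FrameStep.dom_eq (h : A.FrameStep b v a v') : v'.dom = v.dom := by
  ext x
  by_cases hx : x ∈ A.W
  · simp only [h.1.legal_source.subset_dom hx, h.1.legal_target.subset_dom hx]
  · exact PVal.mem_dom_congr (h.2 x hx)

theorem FrameStep.enabled_post (h : A.FrameStep b v a v') (ha : ∀ δ, a ≠ .brecv δ) :
    ∃ l g ρ l', A.Enabled v l g a ρ l' ∧ (b = true ↔ l ∈ A.K) ∧ v' = A.post ρ l' v := by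
  rcases h.1.disc_cases with ⟨l, g, ρ, l', hen, hb, hpost⟩ | ⟨δ, hδ, -⟩
  · refine ⟨l, g, ρ, l', hen, hb, funext fun x => ?_⟩
    by_cases hx : x ∈ A.W
    · exact hpost x hx
    · rw [h.2 x hx, post_of_notMem_W hen.1 h.1.legal_source.subset_dom hx]
  · exact absurd hδ (ha δ)

/-! ### Composable automata -/

/-- The conditions on the components of a network under which its two semantics agree: invariants
and input guards are insensitive to external variables, committed locations can be left, broadcast
inputs do not update external variables and, if enabled at all, lead to some legal state. -/
structure Composable (A : TA X D Δ C) : Prop where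
  inv : ∀ l, NotDependOn A.V A.E (A.I l)
  input_guard : ∀ {l g a ρ l'}, A.tr l g a ρ l' →
    ((∃ δ, a = .brecv δ) ∨ ∃ c, a = .crecv c) → NotDependOn A.V A.E g
  committed : ∀ l ∈ A.K, ∀ v ∈ A.I l, ∃ g a ρ l', A.tr l g a ρ l' ∧ v ∈ g ∧ ρ v ∈ A.I l'
  recv_update : ∀ {l g δ ρ l'}, A.tr l g (.brecv δ) ρ l' →
    ∀ v ∈ (Val A.V : Set (PVal X D)), (ρ v).restrict A.E = v.restrict A.E
  receptive : A.Receptive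

theorem Composable.legal_of_eq_off_E (hA : A.Composable) (hs : A.Legal s) (ht : A.W ⊆ t.dom)
    (hst : ∀ x ∈ A.W, x ∉ A.E → s x = t x) : A.Legal t := by
  obtain ⟨l, hl, hI⟩ := (legal_iff hs.subset_dom).1 hs
  refine (legal_iff ht).2 ⟨l, (hst _ loc_mem_W loc_notMem_E).symm.trans hl, ?_⟩
  exact ((hA.inv l).holds_iff E_subset_V (V_subset_W.trans hs.subset_dom) (V_subset_W.trans ht)
    fun x hx => hst x (V_subset_W hx)).1 hI

theorem Composable.post_of_mem_E (hA : A.Composable) (h : A.tr l g (.brecv δ) ρ l')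
    (hs : A.W ⊆ s.dom) (hx : x ∈ A.E) : A.post ρ l' s x = s x := by
  have hdom := PVal.restrict_dom_of_subset (V_subset_W.trans hs)
  rw [post_of_mem_V h hs (E_subset_V hx),
    PVal.eq_of_restrict_eq (hA.recv_update h _ hdom) hx, PVal.restrict_of_mem (E_subset_V hx)]

theorem Composable.eq_of_mem_E (hA : A.Composable) (h : A.LocalStep b v (.disc (.brecv δ)) v')
    (hx : x ∈ A.E) : v' x = v x := by
  rcases h.disc_cases with ⟨l, g, ρ, l', hen, -, hpost⟩ | ⟨-, -, -, -, hvv'⟩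
  · rw [hpost x (E_subset_W hx), hA.post_of_mem_E hen.1 h.legal_source.subset_dom hx]
  · exact hvv' x (E_subset_W hx)

theorem Composable.exists_localStep_brecv (hA : A.Composable) (δ : Δ) (hv : A.Legal v) :
    ∃ b v', A.LocalStep b v (.disc (.brecv δ)) v' := by
  by_cases hrecv : A.CanReceive δ v
  · obtain ⟨l, g, ρ, l', htr, hl, hg⟩ := hrecv
    obtain ⟨k, hk, hI⟩ := (legal_iff hv.subset_dom).1 hv
    obtain rfl := hl.unique hk
    obtain ⟨g, ρ, l', htr, hg, hI'⟩ := hA.receptive l _ hI δ ⟨g, ρ, l', htr, hg⟩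
    classical
    exact ⟨decide (l ∈ A.K), _, (Enabled.frameStep ⟨htr, hl, hg⟩ decide_eq_true_iff hv
      (legal_post htr hv.subset_dom hI')).1⟩
  · exact ⟨false, v, localStep_of_not_canReceive hrecv hv fun _ _ => rfl⟩

theorem Composable.exists_frameStep_true (hA : A.Composable) (hv : A.Legal v)
    (hK : A.InCommitted v) : ∃ a v', A.FrameStep true v a v' := by
  obtain ⟨l, hl, hI⟩ := (legal_iff hv.subset_dom).1 hv
  have hlK := hl.inCommitted_iff.1 hK
  obtain ⟨g, a, ρ, l', htr, hg, hI'⟩ := hA.committed l hlK _ hI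
  exact ⟨a, _, Enabled.frameStep ⟨htr, hl, hg⟩ (by simp [hlK]) hv
    (legal_post htr hv.subset_dom hI')⟩

namespace FrameStep

theorem eq_of_compatible (h : A.FrameStep b v a w) (hBA : B.Compatible A) (hx : x ∈ B.W)
    (hxE : x ∉ B.E) : w x = v x :=
  h.2 x fun hxA => hxE (hBA.mem_E hx hxA)

theorem at_iff (h : A.FrameStep b v a w) (hBA : B.Compatible A) {l : D B.loc} :
    B.At w l ↔ B.At v l := by
  rw [At, At, h.eq_of_compatible hBA loc_mem_W loc_notMem_E]

theorem inCommitted_iff (h : A.FrameStep b v a w) (hBA : B.Compatible A) :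
    B.InCommitted w ↔ B.InCommitted v :=
  inCommitted_congr (h.eq_of_compatible hBA loc_mem_W loc_notMem_E)

theorem legal (h : A.FrameStep b v a w) (hBA : B.Compatible A) (hB : B.Composable)
    (hv : B.Legal v) : B.Legal w :=
  hB.legal_of_eq_off_E hv (by rw [h.dom_eq]; exact hv.subset_dom)
    fun _ hx hxE => (h.eq_of_compatible hBA hx hxE).symm

theorem enabled_input_iff (h : A.FrameStep b v a w) (hBA : B.Compatible A) (hB : B.Composable)
    (hv : B.W ⊆ v.dom) {l l' : D B.loc} {e : DAct Δ C}
    (he : (∃ δ, e = .brecv δ) ∨ ∃ c, e = .crecv c) :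
    B.Enabled w l g e ρ l' ↔ B.Enabled v l g e ρ l' := by
  refine and_congr_right fun htr => and_congr (h.at_iff hBA) ?_
  exact (hB.input_guard htr he).holds_iff E_subset_V
    (by rw [h.dom_eq]; exact V_subset_W.trans hv) (V_subset_W.trans hv)
    fun x hx hxE => h.eq_of_compatible hBA (V_subset_W hx) hxE

theorem canReceive_iff (h : A.FrameStep b v a w) (hBA : B.Compatible A) (hB : B.Composable)
    (hv : B.W ⊆ v.dom) : B.CanReceive δ w ↔ B.CanReceive δ v := by
  simp only [CanReceive, h.enabled_input_iff hBA hB hv (.inl ⟨δ, rfl⟩)]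

end FrameStep

end TA

/-! ### Subnetworks -/

section Subnetwork

variable {ι : Type*} {A : ι → TA X D Δ C} {J J₁ J₂ : Set ι} {i j k : ι} {b b' : Bool}
  {a : DAct Δ C} {δ : Δ} {u u' v v' w : PVal X D} {x : Var X Y}

/-- The variables, including the location variables, of the subnetwork with index set `J`. -/
def netW (A : ι → TA X D Δ C) (J : Set ι) : Set (Var X Y) := ⋃ i ∈ J, (A i).W

/-- The valuations of the variables of a subnetwork that are legal for each of its members. -/
def netStates (A : ι → TA X D Δ C) (J : Set ι) : Set (PVal X D) :=
  {v | v.dom = netW A J ∧ ∀ i ∈ J, (A i).Legal v}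

theorem mem_netW : x ∈ netW A J ↔ ∃ i ∈ J, x ∈ (A i).W := by
  simp only [netW, Set.mem_iUnion, exists_prop]

theorem W_subset_netW (hi : i ∈ J) : (A i).W ⊆ netW A J :=
  Set.subset_biUnion_of_mem (u := fun i => (A i).W) hi

theorem netW_mono (hJ : J₁ ⊆ J₂) : netW A J₁ ⊆ netW A J₂ := Set.biUnion_subset_biUnion_left hJ

theorem netW_union : netW A (J₁ ∪ J₂) = netW A J₁ ∪ netW A J₂ := Set.biUnion_union _ _ _

theorem netW_singleton : netW A {i} = (A i).W := Set.biUnion_singleton _ _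

theorem netStates_singleton : netStates A {i} = (A i).states := by
  ext v
  simp only [netStates, netW_singleton, Set.mem_singleton_iff, forall_eq, Set.mem_ofPred_eq,
    TA.mem_states_iff]

theorem restrict_mem_netStates (hv : v ∈ netStates A J₂) (hJ : J₁ ⊆ J₂) :
    v.restrict (netW A J₁) ∈ netStates A J₁ :=
  ⟨PVal.restrict_dom_of_subset (hv.1 ▸ netW_mono hJ), fun i hi =>
    (TA.legal_congr fun _ hx => PVal.restrict_of_mem (W_subset_netW hi hx)).2 (hv.2 i (hJ hi))⟩

/-! ### Broadcast reception -/

/-- All members of `J` react to the broadcast `δ` at the same time, without changing any further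
variables. -/
structure ReceiveStep (A : ι → TA X D Δ C) (J : Set ι) (b : Bool) (v : PVal X D) (δ : Δ)
    (v' : PVal X D) : Prop where
  step : ∀ j ∈ J, ∃ b', (A j).LocalStep b' v (.disc (.brecv δ)) v'
  frame : ∀ x ∉ netW A J, v' x = v x
  flag : b = true ↔ ∃ j ∈ J, (A j).LocalStep true v (.disc (.brecv δ)) v'

theorem receiveStep_empty : ReceiveStep A ∅ b v δ v' ↔ b = false ∧ v' = v := by
  constructor
  · intro h
    refine ⟨?_, funext fun x => h.frame x (by simp [netW])⟩
    simpa using h.flag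
  · rintro ⟨rfl, rfl⟩
    exact ⟨by simp, fun _ _ => rfl, by simp⟩

theorem receiveStep_singleton :
    ReceiveStep A {i} b v δ v' ↔ (A i).FrameStep b v (.brecv δ) v' := by
  constructor
  · intro h
    obtain ⟨b', hb'⟩ := h.step i rfl
    have hflag := h.flag
    simp only [Set.mem_singleton_iff, exists_eq_left] at hflag
    refine ⟨?_, netW_singleton (A := A) ▸ h.frame⟩
    obtain rfl : b = b' := by
      rw [Bool.eq_iff_iff, hflag]
      exact ⟨fun h => hb'.flag_unique h, by rintro rfl; exact hb'⟩
    exact hb'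
  · rintro ⟨hstep, hframe⟩
    refine ⟨fun j hj => ⟨b, by rwa [Set.mem_singleton_iff.1 hj]⟩, by rwa [netW_singleton], ?_⟩
    simp only [Set.mem_singleton_iff, exists_eq_left]
    exact ⟨by rintro rfl; exact hstep, fun h => hstep.flag_unique h⟩

namespace ReceiveStep

theorem eq_of_notMem (h : ReceiveStep A J b v δ v')
    (hc : Pairwise fun i j => (A i).Compatible (A j)) (hA : ∀ i, (A i).Composable)
    (hk : k ∉ J) (hx : x ∈ (A k).W) : v' x = v x := by
  by_cases hxJ : x ∈ netW A J
  · obtain ⟨j, hj, hxj⟩ := mem_netW.1 hxJ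
    obtain ⟨b', hstep⟩ := h.step j hj
    exact (hA j).eq_of_mem_E hstep ((hc (ne_of_mem_of_not_mem hj hk)).mem_E hxj hx)
  · exact h.frame x hxJ

theorem legal (h : ReceiveStep A J b v δ v')
    (hc : Pairwise fun i j => (A i).Compatible (A j)) (hA : ∀ i, (A i).Composable)
    (hk : (A k).Legal v) : (A k).Legal v' := by
  by_cases hkJ : k ∈ J
  · exact (h.step k hkJ).choose_spec.legal_target
  · exact (TA.legal_congr fun x hx => h.eq_of_notMem hc hA hkJ hx).2 hk

theorem dom_eq (h : ReceiveStep A J b v δ v') : v'.dom = v.dom := by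
  ext x
  by_cases hx : x ∈ netW A J
  · obtain ⟨j, hj, hxj⟩ := mem_netW.1 hx
    obtain ⟨b', hstep⟩ := h.step j hj
    simp only [hstep.legal_source.subset_dom hxj, hstep.legal_target.subset_dom hxj]
  · exact PVal.mem_dom_congr (h.frame x hx)

theorem congr (h : ReceiveStep A J b v δ v') (hu : ∀ x ∈ netW A J, u x = v x)
    (hu' : ∀ x ∈ netW A J, u' x = v' x) (hframe : ∀ x ∉ netW A J, u' x = u x) :
    ReceiveStep A J b u δ u' := by
  have hlocal : ∀ {b j}, j ∈ J → ((A j).LocalStep b u (.disc (.brecv δ)) u' ↔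
      (A j).LocalStep b v (.disc (.brecv δ)) v') := fun hj =>
    TA.localStep_congr (fun x hx => hu x (W_subset_netW hj hx))
      fun x hx => hu' x (W_subset_netW hj hx)
  refine ⟨fun j hj => (h.step j hj).imp fun _ => (hlocal hj).2, hframe, h.flag.trans ?_⟩
  exact exists_congr fun j => and_congr_right fun hj => (hlocal hj).symm

theorem union {b₁ b₂ : Bool} (h₁ : ReceiveStep A J₁ b₁ v δ w) (h₂ : ReceiveStep A J₂ b₂ w δ v')
    (hc : Pairwise fun i j => (A i).Compatible (A j)) (hA : ∀ i, (A i).Composable)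
    (hJ : Disjoint J₁ J₂) : ReceiveStep A (J₁ ∪ J₂) (b₁ || b₂) v δ v' := by
  have hlocal₁ : ∀ {b j}, j ∈ J₁ → ((A j).LocalStep b v (.disc (.brecv δ)) w ↔
      (A j).LocalStep b v (.disc (.brecv δ)) v') := fun hj =>
    TA.localStep_congr (fun _ _ => rfl) fun x hx =>
      (h₂.eq_of_notMem hc hA (Set.disjoint_left.1 hJ hj) hx).symm
  have hlocal₂ : ∀ {b j}, j ∈ J₂ → ((A j).LocalStep b w (.disc (.brecv δ)) v' ↔
      (A j).LocalStep b v (.disc (.brecv δ)) v') := fun hj =>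
    TA.localStep_congr (fun x hx => h₁.eq_of_notMem hc hA (Set.disjoint_right.1 hJ hj) hx)
      fun _ _ => rfl
  refine ⟨?_, fun x hx => ?_, ?_⟩
  · rintro j (hj | hj)
    · exact (h₁.step j hj).imp fun _ => (hlocal₁ hj).1
    · exact (h₂.step j hj).imp fun _ => (hlocal₂ hj).1
  · rw [netW_union, Set.mem_union, not_or] at hx
    exact (h₂.frame x hx.2).trans (h₁.frame x hx.1)
  · simp only [Bool.or_eq_true, h₁.flag, h₂.flag, Set.mem_union, or_and_right, exists_or]
    exact or_congr (exists_congr fun j => and_congr_right hlocal₁)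
      (exists_congr fun j => and_congr_right hlocal₂)

open Classical in
theorem exists_of_union (h : ReceiveStep A (J₁ ∪ J₂) b v δ v')
    (hc : Pairwise fun i j => (A i).Compatible (A j)) (hA : ∀ i, (A i).Composable)
    (hJ : Disjoint J₁ J₂) : ∃ b₁ b₂ w, ReceiveStep A J₁ b₁ v δ w ∧ ReceiveStep A J₂ b₂ w δ v' ∧
      b = (b₁ || b₂) := by
  let w := (netW A J₁).piecewise v' v
  have hw_mem : ∀ x ∈ netW A J₁, w x = v' x := fun x hx => Set.piecewise_eq_of_mem _ _ _ hx
  have hw_notMem : ∀ x ∉ netW A J₁, w x = v x := fun x hx => Set.piecewise_eq_of_notMem _ _ _ hx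
  have hw_right : ∀ j ∈ J₂, ∀ x ∈ (A j).W, w x = v x := fun j hj x hx => by
    by_cases hxJ : x ∈ netW A J₁
    · obtain ⟨i, hi, hxi⟩ := mem_netW.1 hxJ
      obtain ⟨b', hstep⟩ := h.step i (.inl hi)
      rw [hw_mem x hxJ]
      exact (hA i).eq_of_mem_E hstep ((hc (hJ.ne_of_mem hi hj)).mem_E hxi hx)
    · exact hw_notMem x hxJ
  have hlocal₁ : ∀ {b j}, j ∈ J₁ → ((A j).LocalStep b v (.disc (.brecv δ)) w ↔
      (A j).LocalStep b v (.disc (.brecv δ)) v') := fun hj =>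
    TA.localStep_congr (fun _ _ => rfl) fun x hx => hw_mem x (W_subset_netW hj hx)
  have hlocal₂ : ∀ {b j}, j ∈ J₂ → ((A j).LocalStep b w (.disc (.brecv δ)) v' ↔
      (A j).LocalStep b v (.disc (.brecv δ)) v') := fun {b j} hj =>
    TA.localStep_congr (hw_right j hj) fun _ _ => rfl
  refine ⟨decide (∃ j ∈ J₁, (A j).LocalStep true v (.disc (.brecv δ)) w),
    decide (∃ j ∈ J₂, (A j).LocalStep true w (.disc (.brecv δ)) v'), w,
    ⟨fun j hj => (h.step j (.inl hj)).imp fun _ => (hlocal₁ hj).2, hw_notMem,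
      decide_eq_true_iff⟩,
    ⟨fun j hj => (h.step j (.inr hj)).imp fun _ => (hlocal₂ hj).2, fun x hx => ?_,
      decide_eq_true_iff⟩, ?_⟩
  · by_cases hxJ : x ∈ netW A J₁
    · exact (hw_mem x hxJ).symm
    · rw [hw_notMem x hxJ]
      refine h.frame x ?_
      simp only [netW_union, Set.mem_union, hxJ, hx, or_self, not_false_eq_true]
  · rw [Bool.eq_iff_iff, h.flag, Bool.or_eq_true, decide_eq_true_iff, decide_eq_true_iff]
    simp only [Set.mem_union, or_and_right, exists_or]
    exact (or_congr (exists_congr fun j => and_congr_right hlocal₁)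
      (exists_congr fun j => and_congr_right hlocal₂)).symm

end ReceiveStep

open Classical in
theorem exists_receiveStep (hc : Pairwise fun i j => (A i).Compatible (A j))
    (hA : ∀ i, (A i).Composable) (δ : Δ) (hv : ∀ i ∈ J, (A i).Legal v) :
    ∃ b v', ReceiveStep A J b v δ v' := by
  choose! b w hstep using fun i hi => (hA i).exists_localStep_brecv δ (hv i hi)
  let owned (x : Var X Y) (j : ι) : Prop := j ∈ J ∧ x ∈ (A j).W ∧ x ∉ (A j).E
  let v' : PVal X D := fun x => if hx : ∃ j, owned x j then w hx.choose x else v x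
  have howner : ∀ {x j}, x ∈ (A j).W → (hx : ∃ j, owned x j) →
      x ∉ (A j).E → hx.choose = j := by
    intro x j hxj hx hxE
    by_contra hne
    exact hxE ((hc (Ne.symm hne)).mem_E hxj hx.choose_spec.2.1)
  have hv' : ∀ j ∈ J, ∀ x ∈ (A j).W, v' x = w j x := by
    intro j hj x hxj
    by_cases hxE : x ∈ (A j).E
    · have hnone : ¬ ∃ k, owned x k := by
        rintro ⟨k, -, hxk, hxkE⟩
        rcases eq_or_ne k j with rfl | hne
        · exact hxkE hxE
        · exact hxkE ((hc hne).mem_E hxk hxj)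
      simp only [v', dif_neg hnone, (hA j).eq_of_mem_E (hstep j hj) hxE]
    · have hex : ∃ k, owned x k := ⟨j, hj, hxj, hxE⟩
      simp only [v', dif_pos hex, howner hxj hex hxE]
  refine ⟨decide (∃ j ∈ J, (A j).LocalStep true v (.disc (.brecv δ)) v'), v', fun j hj =>
    ⟨b j, (TA.localStep_congr (fun _ _ => rfl) (hv' j hj)).2 (hstep j hj)⟩, fun x hx => ?_,
    decide_eq_true_iff⟩
  exact dif_neg fun ⟨j, hj, hxj, _⟩ => hx (W_subset_netW hj hxj)

/-! ### Discrete transitions of subnetworks -/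

/-- The discrete transitions of the subnetwork with index set `J`, inside valuations of a larger set
of variables: a transition is a sequential composition of transitions of its members. -/
inductive NetStep (A : ι → TA X D Δ C) (J : Set ι) :
    Bool → PVal X D → DAct Δ C → PVal X D → Prop
  | csend {b : Bool} {v v' : PVal X D} {i : ι} {c : C} : i ∈ J →
      (A i).FrameStep b v (.csend c) v' → NetStep A J b v (.csend c) v'
  | crecv {b : Bool} {v v' : PVal X D} {i : ι} {c : C} : i ∈ J →
      (A i).FrameStep b v (.crecv c) v' → NetStep A J b v (.crecv c) v'
  | tau {b : Bool} {v v' : PVal X D} {i : ι} : i ∈ J → (A i).FrameStep b v .tau v' →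
      (∀ k ∈ J, (A k).InCommitted v → b = true) → NetStep A J b v .tau v'
  | sync {b b' : Bool} {v w v' : PVal X D} {i j : ι} {c : C} : i ∈ J → j ∈ J → i ≠ j →
      (A i).FrameStep b v (.csend c) w → (A j).FrameStep b' w (.crecv c) v' →
      (∀ k ∈ J, (A k).InCommitted v → (b || b') = true) → NetStep A J (b || b') v .tau v'
  | snd {b b' : Bool} {v w v' : PVal X D} {i : ι} {δ : Δ} : i ∈ J →
      (A i).FrameStep b v (.bsend δ) w → ReceiveStep A (J \ {i}) b' w δ v' →
      NetStep A J (b || b') v (.bsend δ) v'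
  | rcv {b : Bool} {v v' : PVal X D} {δ : Δ} : ReceiveStep A J b v δ v' →
      NetStep A J b v (.brecv δ) v'

theorem netStep_brecv_iff : NetStep A J b v (.brecv δ) v' ↔ ReceiveStep A J b v δ v' :=
  ⟨fun | .rcv h => h, .rcv⟩

theorem netStep_singleton : NetStep A {i} b v a v' ↔ (A i).FrameStep b v a v' := by
  constructor
  · intro h
    cases h with
    | csend hi h | crecv hi h | tau hi h => rwa [Set.mem_singleton_iff.1 hi] at h
    | sync hi hj hij => exact absurd (hi.trans hj.symm) hij
    | snd hi h hr =>
      obtain rfl := Set.mem_singleton_iff.1 hi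
      rw [sdiff_self, Set.bot_eq_empty, receiveStep_empty] at hr
      obtain ⟨rfl, rfl⟩ := hr
      rwa [Bool.or_false]
    | rcv h => exact receiveStep_singleton.1 h
  · intro h
    cases a with
    | csend c => exact .csend rfl h
    | crecv c => exact .crecv rfl h
    | tau =>
      refine .tau rfl h ?_
      rintro _ rfl hK
      exact h.1.flag_iff.2 ⟨hK, fun _ hδ => nomatch hδ⟩
    | bsend δ =>
      rw [← Bool.or_false b]
      refine .snd rfl h ?_
      rw [sdiff_self, Set.bot_eq_empty, receiveStep_empty]
      exact ⟨rfl, rfl⟩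
    | brecv δ => exact .rcv (receiveStep_singleton.2 h)

theorem TA.FrameStep.legal_all (h : (A i).FrameStep b v a v')
    (hc : Pairwise fun i j => (A i).Compatible (A j)) (hA : ∀ i, (A i).Composable)
    (hk : (A k).Legal v) : (A k).Legal v' := by
  rcases eq_or_ne k i with rfl | hki
  · exact h.1.legal_target
  · exact h.legal (hc hki) (hA k) hk

theorem TA.FrameStep.congr {A : TA X D Δ C} {Z : Set (Var X Y)} (h : A.FrameStep b v a v')
    (hZ : A.W ⊆ Z) (hu : ∀ x ∈ Z, u x = v x) (hu' : ∀ x ∈ Z, u' x = v' x)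
    (hframe : ∀ x ∉ Z, u' x = u x) : A.FrameStep b u a u' := by
  refine ⟨(localStep_congr (fun x hx => hu x (hZ hx)) fun x hx => hu' x (hZ hx)).2 h.1,
    fun x hx => ?_⟩
  by_cases hxZ : x ∈ Z
  · rw [hu' x hxZ, h.2 x hx, hu x hxZ]
  · exact hframe x hxZ

namespace NetStep

theorem legal (h : NetStep A J b v a v') (hc : Pairwise fun i j => (A i).Compatible (A j))
    (hA : ∀ i, (A i).Composable) (hk : (A k).Legal v) : (A k).Legal v' := by
  cases h with
  | csend _ h | crecv _ h | tau _ h => exact h.legal_all hc hA hk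
  | sync _ _ _ h h' => exact h'.legal_all hc hA (h.legal_all hc hA hk)
  | snd _ h hr => exact hr.legal hc hA (h.legal_all hc hA hk)
  | rcv hr => exact hr.legal hc hA hk

theorem dom_eq (h : NetStep A J b v a v') : v'.dom = v.dom := by
  cases h with
  | csend _ h | crecv _ h | tau _ h => exact h.dom_eq
  | sync _ _ _ h h' => exact h'.dom_eq.trans h.dom_eq
  | snd _ h hr => exact hr.dom_eq.trans h.dom_eq
  | rcv hr => exact hr.dom_eq

theorem mem_netStates (h : NetStep A J₁ b v a v') (hc : Pairwise fun i j => (A i).Compatible (A j))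
    (hA : ∀ i, (A i).Composable) (hv : v ∈ netStates A J) : v' ∈ netStates A J :=
  ⟨h.dom_eq.trans hv.1, fun i hi => h.legal hc hA (hv.2 i hi)⟩

theorem restrict_eq_of_brecv (h : NetStep A J₁ b v (.brecv δ) v')
    (hc : Pairwise fun i j => (A i).Compatible (A j)) (hA : ∀ i, (A i).Composable)
    (hJ : Disjoint J₁ J₂) : v'.restrict (netW A J₂) = v.restrict (netW A J₂) :=
  PVal.restrict_congr fun _ hx => by
    obtain ⟨k, hk, hxk⟩ := mem_netW.1 hx
    exact (netStep_brecv_iff.1 h).eq_of_notMem hc hA (Set.disjoint_right.1 hJ hk) hxk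

theorem frame (h : NetStep A J b v a v') (hx : x ∉ netW A J) : v' x = v x := by
  have hnotMem : ∀ {i}, i ∈ J → x ∉ (A i).W := fun hi hxi => hx (W_subset_netW hi hxi)
  cases h with
  | csend hi h | crecv hi h | tau hi h => exact h.2 x (hnotMem hi)
  | sync hi hj _ h h' => exact (h'.2 x (hnotMem hj)).trans (h.2 x (hnotMem hi))
  | snd hi h hr =>
    exact (hr.frame x fun hx' => hx (netW_mono Set.sdiff_subset hx')).trans (h.2 x (hnotMem hi))
  | rcv hr => exact hr.frame x hx

open Classical in
theorem congr (h : NetStep A J b v a v') (hu : ∀ x ∈ netW A J, u x = v x)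
    (hu' : ∀ x ∈ netW A J, u' x = v' x) (hframe : ∀ x ∉ netW A J, u' x = u x) :
    NetStep A J b u a u' := by
  have hK : ∀ {b : Bool}, (∀ k ∈ J, (A k).InCommitted v → b = true) →
      ∀ k ∈ J, (A k).InCommitted u → b = true := fun h k hk hku =>
    h k hk ((TA.inCommitted_congr (hu _ (W_subset_netW hk TA.loc_mem_W))).1 hku)
  have hmid (w) (x) (hx : x ∈ netW A J) : (netW A J).piecewise w u x = w x :=
    Set.piecewise_eq_of_mem _ _ _ hx
  have hmid_frame (w : PVal X D) (x) (hx : x ∉ netW A J) : (netW A J).piecewise w u x = u x :=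
    Set.piecewise_eq_of_notMem _ _ _ hx
  have hmid_frame' (w : PVal X D) (x) (hx : x ∉ netW A J) :
      u' x = (netW A J).piecewise w u x := (hframe x hx).trans (hmid_frame w x hx).symm
  cases h with
  | csend hi h => exact .csend hi (h.congr (W_subset_netW hi) hu hu' hframe)
  | crecv hi h => exact .crecv hi (h.congr (W_subset_netW hi) hu hu' hframe)
  | tau hi h hb => exact .tau hi (h.congr (W_subset_netW hi) hu hu' hframe) (hK hb)
  | @sync _ _ _ w _ _ _ _ hi hj hij h h' hb =>
    exact .sync hi hj hij (h.congr (W_subset_netW hi) hu (hmid w) (hmid_frame w))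
      (h'.congr (W_subset_netW hj) (hmid w) hu' (hmid_frame' w)) (hK hb)
  | @snd _ _ _ w _ i δ hi h hr =>
    have hsub : netW A (J \ {i}) ⊆ netW A J := netW_mono Set.sdiff_subset
    refine .snd hi (h.congr (W_subset_netW hi) hu (hmid w) (hmid_frame w))
      (hr.congr (fun x hx => hmid w x (hsub hx)) (fun x hx => hu' x (hsub hx)) fun x hx => ?_)
    by_cases hxJ : x ∈ netW A J
    · rw [hu' x hxJ, hmid w x hxJ, hr.frame x hx]
    · exact hmid_frame' w x hxJ
  | rcv hr => exact .rcv (hr.congr hu hu' hframe)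

theorem restrict (h : NetStep A J b v a v') :
    NetStep A J b (v.restrict (netW A J)) a (v'.restrict (netW A J)) :=
  h.congr (fun _ hx => PVal.restrict_of_mem hx) (fun _ hx => PVal.restrict_of_mem hx)
    fun _ hx => (PVal.restrict_of_notMem hx).trans (PVal.restrict_of_notMem hx).symm

theorem override (h : NetStep A J b v a v') (hv : v.dom = netW A J) (f : PVal X D) :
    NetStep A J b (v.override f) a (v'.override f) := by
  have hv' : v'.dom = netW A J := h.dom_eq.trans hv
  refine h.congr (fun _ hx => PVal.override_of_mem (hv ▸ hx))
    (fun _ hx => PVal.override_of_mem (hv' ▸ hx)) fun _ hx => ?_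
  rw [PVal.override_of_notMem (hv' ▸ hx), PVal.override_of_notMem (hv ▸ hx)]

theorem restrict_override_restrict (h : NetStep A J₁ b v a v')
    (hv : v.dom = netW A J₁ ∪ netW A J₂) :
    (v'.restrict (netW A J₁)).override (v.restrict (netW A J₂)) = v' :=
  PVal.restrict_override_restrict hv.le (fun _ => h.frame)
    (h.dom_eq ▸ hv ▸ Set.subset_union_left)

theorem restrict_update_restrict (h : NetStep A J₁ b v a v')
    (hv : v.dom = netW A J₁ ∪ netW A J₂) :
    (v.restrict (netW A J₂)).update (v'.restrict (netW A J₁)) = v'.restrict (netW A J₂) := by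
  rw [PVal.update, h.restrict_override_restrict hv,
    PVal.restrict_dom_of_subset (hv ▸ Set.subset_union_right)]

theorem exists_inCommitted (h : NetStep A J true v a v')
    (hc : Pairwise fun i j => (A i).Compatible (A j)) : ∃ k ∈ J, (A k).InCommitted v := by
  generalize hb : true = b at h
  cases h with
  | csend hi h | crecv hi h | tau hi h =>
    subst hb
    exact ⟨_, hi, h.1.inCommitted⟩
  | sync hi hj hij h h' =>
    rcases Bool.or_eq_true_iff.1 hb.symm with rfl | rfl
    · exact ⟨_, hi, h.1.inCommitted⟩
    · exact ⟨_, hj, (h.inCommitted_iff (hc hij.symm)).1 h'.1.inCommitted⟩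
  | snd hi h hr =>
    rcases Bool.or_eq_true_iff.1 hb.symm with rfl | rfl
    · exact ⟨_, hi, h.1.inCommitted⟩
    · obtain ⟨j, ⟨hj, hji⟩, h'⟩ := hr.flag.1 rfl
      exact ⟨j, hj, (h.inCommitted_iff (hc hji)).1 h'.inCommitted⟩
  | rcv hr =>
    obtain ⟨j, hj, h⟩ := hr.flag.1 hb.symm
    exact ⟨j, hj, h.inCommitted⟩

end NetStep

theorem exists_netStep_true (hc : Pairwise fun i j => (A i).Compatible (A j))
    (hA : ∀ i, (A i).Composable) (hv : ∀ i ∈ J, (A i).Legal v) (hk : k ∈ J)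
    (hK : (A k).InCommitted v) : ∃ a v', NetStep A J true v a v' := by
  obtain ⟨a, w, h⟩ := (hA k).exists_frameStep_true (hv k hk) hK
  have hrecv (δ : Δ) : ∃ b v', ReceiveStep A (J \ {k}) b w δ v' :=
    exists_receiveStep hc hA δ fun i hi => h.legal_all hc hA (hv i hi.1)
  cases a with
  | csend c => exact ⟨_, w, .csend hk h⟩
  | crecv c => exact ⟨_, w, .crecv hk h⟩
  | tau => exact ⟨_, w, .tau hk h fun _ _ _ => rfl⟩
  | bsend δ =>
    obtain ⟨b, v', hr⟩ := hrecv δ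
    exact ⟨_, v', NetStep.snd (b := true) hk h hr⟩
  | brecv δ =>
    obtain ⟨b, v', hr⟩ := hrecv δ
    have hunion := (receiveStep_singleton.2 h).union hr hc hA Set.disjoint_sdiff_right
    rw [Set.union_sdiff_cancel (Set.singleton_subset_iff.2 hk), Bool.true_or] at hunion
    exact ⟨_, v', .rcv hunion⟩

/-- The discrete transitions of the parallel composition of the subnetworks with index sets `J₁`
and `J₂`, on valuations of all variables, with `J₁` in the role of component `i` of the rules for
`TTSB.ParStep`. -/
inductive SplitStep (A : ι → TA X D Δ C) (J₁ J₂ : Set ι) :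
    Bool → PVal X D → DAct Δ C → PVal X D → Prop
  | ext {b : Bool} {v v' : PVal X D} {a : DAct Δ C} :
      ((∃ c, a = .csend c) ∨ ∃ c, a = .crecv c) → NetStep A J₁ b v a v' →
      SplitStep A J₁ J₂ b v a v'
  | tau {b : Bool} {v v' : PVal X D} : NetStep A J₁ b v .tau v' →
      (∀ k ∈ J₂, (A k).InCommitted v → b = true) → SplitStep A J₁ J₂ b v .tau v'
  | sync {b b' : Bool} {v w v' : PVal X D} {c : C} :
      NetStep A J₁ b v (.csend c) w → NetStep A J₂ b' w (.crecv c) v' →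
      (∀ k ∈ J₁ ∪ J₂, (A k).InCommitted v → (b || b') = true) →
      SplitStep A J₁ J₂ (b || b') v .tau v'
  | snd {b b' : Bool} {v w v' : PVal X D} {δ : Δ} :
      NetStep A J₁ b v (.bsend δ) w → NetStep A J₂ b' w (.brecv δ) v' →
      SplitStep A J₁ J₂ (b || b') v (.bsend δ) v'
  | rcv {b b' : Bool} {v w v' : PVal X D} {δ : Δ} :
      NetStep A J₁ b v (.brecv δ) w → NetStep A J₂ b' w (.brecv δ) v' →
      SplitStep A J₁ J₂ (b || b') v (.brecv δ) v'

theorem SplitStep.of_tau (hi : i ∈ J₁) (h : (A i).FrameStep b v .tau v')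
    (hb : ∀ k ∈ J₁ ∪ J₂, (A k).InCommitted v → b = true) : SplitStep A J₁ J₂ b v .tau v' :=
  .tau (.tau hi h fun k hk => hb k (.inl hk)) fun k hk => hb k (.inr hk)

theorem SplitStep.of_sync {c : C} (hi : i ∈ J₁) (hj : j ∈ J₁ ∪ J₂) (hij : i ≠ j)
    (h : (A i).FrameStep b v (.csend c) w) (h' : (A j).FrameStep b' w (.crecv c) v')
    (hb : ∀ k ∈ J₁ ∪ J₂, (A k).InCommitted v → (b || b') = true) :
    SplitStep A J₁ J₂ (b || b') v .tau v' := by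
  rcases hj with hj | hj
  · exact .tau (.sync hi hj hij h h' fun k hk => hb k (.inl hk)) fun k hk => hb k (.inr hk)
  · exact .sync (.csend hi h) (.crecv hj h') hb

theorem SplitStep.of_snd (hc : Pairwise fun i j => (A i).Compatible (A j))
    (hA : ∀ i, (A i).Composable) (hJ : Disjoint J₁ J₂) (hi : i ∈ J₁)
    (h : (A i).FrameStep b v (.bsend δ) w) (hr : ReceiveStep A ((J₁ ∪ J₂) \ {i}) b' w δ v') :
    SplitStep A J₁ J₂ (b || b') v (.bsend δ) v' := by
  rw [Set.union_sdiff_distrib, Set.sdiff_singleton_eq_self (Set.disjoint_left.1 hJ hi)] at hr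
  obtain ⟨b₁, b₂, w', hr₁, hr₂, rfl⟩ :=
    hr.exists_of_union hc hA (hJ.mono_left Set.sdiff_subset)
  rw [← Bool.or_assoc]
  exact .snd (.snd hi h hr₁) (.rcv hr₂)

theorem NetStep.split (h : NetStep A (J₁ ∪ J₂) b v a v')
    (hc : Pairwise fun i j => (A i).Compatible (A j)) (hA : ∀ i, (A i).Composable)
    (hJ : Disjoint J₁ J₂) : SplitStep A J₁ J₂ b v a v' ∨ SplitStep A J₂ J₁ b v a v' := by
  cases h with
  | csend hi h =>
    exact hi.imp (fun hi => .ext (.inl ⟨_, rfl⟩) (.csend hi h))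
      fun hi => .ext (.inl ⟨_, rfl⟩) (.csend hi h)
  | crecv hi h =>
    exact hi.imp (fun hi => .ext (.inr ⟨_, rfl⟩) (.crecv hi h))
      fun hi => .ext (.inr ⟨_, rfl⟩) (.crecv hi h)
  | tau hi h hb => exact hi.imp (.of_tau · h hb) (.of_tau · h (Set.union_comm _ _ ▸ hb))
  | sync hi hj hij h h' hb =>
    exact hi.imp (.of_sync · hj hij h h' hb)
      (.of_sync · hj.symm hij h h' (Set.union_comm _ _ ▸ hb))
  | snd hi h hr =>
    exact hi.imp (.of_snd hc hA hJ · h hr)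
      (.of_snd hc hA hJ.symm · h (Set.union_comm _ _ ▸ hr))
  | rcv hr =>
    obtain ⟨b₁, b₂, w, hr₁, hr₂, rfl⟩ := hr.exists_of_union hc hA hJ
    exact .inl (.rcv (.rcv hr₁) (.rcv hr₂))

theorem SplitStep.netStep (h : SplitStep A J₁ J₂ b v a v')
    (hc : Pairwise fun i j => (A i).Compatible (A j)) (hA : ∀ i, (A i).Composable)
    (hJ : Disjoint J₁ J₂) : NetStep A (J₁ ∪ J₂) b v a v' := by
  cases h with
  | ext ha h =>
    rcases ha with ⟨c, rfl⟩ | ⟨c, rfl⟩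
    · cases h with | csend hi h => exact .csend (.inl hi) h
    · cases h with | crecv hi h => exact .crecv (.inl hi) h
  | tau h hb₂ =>
    cases h with
    | tau hi h hb₁ => exact .tau (.inl hi) h fun k hk => hk.elim (hb₁ k) (hb₂ k)
    | sync hi hj hij h h' hb₁ =>
      exact .sync (.inl hi) (.inl hj) hij h h' fun k hk => hk.elim (hb₁ k) (hb₂ k)
  | sync h h' hb =>
    cases h with | csend hi h =>
    cases h' with | crecv hj h' =>
    exact .sync (.inl hi) (.inr hj) (hJ.ne_of_mem hi hj) h h' hb
  | snd h h' =>
    cases h with | snd hi h hr =>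
    cases h' with | rcv hr' =>
    rw [Bool.or_assoc]
    refine .snd (.inl hi) h ?_
    rw [Set.union_sdiff_distrib, Set.sdiff_singleton_eq_self (Set.disjoint_left.1 hJ hi)]
    exact hr.union hr' hc hA (hJ.mono_left Set.sdiff_subset)
  | rcv h h' => exact .rcv ((netStep_brecv_iff.1 h).union (netStep_brecv_iff.1 h') hc hA hJ)

theorem netStep_union_iff (hc : Pairwise fun i j => (A i).Compatible (A j))
    (hA : ∀ i, (A i).Composable) (hJ : Disjoint J₁ J₂) :
    NetStep A (J₁ ∪ J₂) b v a v' ↔ SplitStep A J₁ J₂ b v a v' ∨ SplitStep A J₂ J₁ b v a v' := by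
  refine ⟨fun h => h.split hc hA hJ, ?_⟩
  rintro (h | h)
  · exact h.netStep hc hA hJ
  · exact Set.union_comm J₂ J₁ ▸ h.netStep hc hA hJ.symm

/-! ### Parallel composition -/

/-- All members of `J` let `d` units of time pass, and so do all other variables. -/
def DelayStep (A : ι → TA X D Δ C) (J : Set ι) (d : ℝ≥0) (v v' : PVal X D) : Prop :=
  v' = v.delay d ∧ ∀ i ∈ J, (A i).LocalStep false v (.delay d) v'

/-- `T` is the subnetwork with index set `J`, viewed as a single transition system. -/
structure Represents (T : TTSB X D Δ C) (A : ι → TA X D Δ C) (J : Set ι) : Prop where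
  S_eq : T.S = netStates A J
  disc_iff : ∀ {b v a v'}, T.tr b v (.disc a) v' ↔ v ∈ netStates A J ∧ NetStep A J b v a v'
  delay_iff : ∀ {b v d v'}, T.tr b v (.delay d) v' ↔
    v ∈ netStates A J ∧ b = false ∧ DelayStep A J d v v'

theorem override_mem_netStates {r s : PVal X D} (hr : r ∈ netStates A J₁) (hs : s ∈ netStates A J₂)
    (hrs : r.Compat s) : r.override s ∈ netStates A (J₁ ∪ J₂) := by
  refine ⟨by rw [PVal.override_dom, hr.1, hs.1, netW_union], ?_⟩
  rintro i (hi | hi)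
  · refine (TA.legal_congr fun x hx => PVal.override_of_mem ?_).2 (hr.2 i hi)
    exact hr.1 ▸ W_subset_netW hi hx
  · rw [hrs.override_comm]
    refine (TA.legal_congr fun x hx => PVal.override_of_mem ?_).2 (hs.2 i hi)
    exact hs.1 ▸ W_subset_netW hi hx

theorem restrict_override_restrict_netW (hv : v ∈ netStates A (J₁ ∪ J₂)) :
    (v.restrict (netW A J₁)).override (v.restrict (netW A J₂)) = v := by
  have hdom : v.dom = netW A J₁ ∪ netW A J₂ := hv.1.trans netW_union
  exact PVal.restrict_override_restrict hdom.le (fun _ _ => rfl)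
    (hdom ▸ Set.subset_union_left)

namespace Represents

variable {T T₁ T₂ : TTSB X D Δ C} {d : ℝ≥0}

theorem comm_iff (hT : Represents T A J) (hc : Pairwise fun i j => (A i).Compatible (A j))
    (hA : ∀ i, (A i).Composable) (hv : v ∈ netStates A J) :
    T.Comm v ↔ ∃ k ∈ J, (A k).InCommitted v := by
  constructor
  · rintro ⟨a | d, t, h⟩
    · exact (hT.disc_iff.1 h).2.exists_inCommitted hc
    · cases (hT.delay_iff.1 h).2.1
  · rintro ⟨k, hk, hK⟩
    obtain ⟨a, t, h⟩ := exists_netStep_true hc hA hv.2 hk hK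
    exact ⟨.disc a, t, hT.disc_iff.2 ⟨hv, h⟩⟩

theorem restrict_mem (hT : Represents T A J) (hv : v ∈ netStates A J₂) (hJ : J ⊆ J₂) :
    v.restrict (netW A J) ∈ T.S :=
  hT.S_eq ▸ restrict_mem_netStates hv hJ

theorem tr_restrict (hT : Represents T A J) (h : NetStep A J b v a v') (hv : v ∈ netStates A J₂)
    (hJ : J ⊆ J₂) : T.tr b (v.restrict (netW A J)) (.disc a) (v'.restrict (netW A J)) :=
  hT.disc_iff.2 ⟨restrict_mem_netStates hv hJ, h.restrict⟩

theorem netStep_override (hT : Represents T A J) {r r' : PVal X D} (h : T.tr b r (.disc a) r')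
    (f : PVal X D) : NetStep A J b (r.override f) a (r'.override f) := by
  obtain ⟨hr, hstep⟩ := hT.disc_iff.1 h
  exact hstep.override hr.1 f

theorem comm_of_inCommitted (hT : Represents T A J)
    (hc : Pairwise fun i j => (A i).Compatible (A j)) (hA : ∀ i, (A i).Composable)
    {r : PVal X D} (hr : r ∈ T.S) (f : PVal X D) (hk : k ∈ J)
    (hK : (A k).InCommitted (r.override f)) : T.Comm r := by
  rw [hT.S_eq] at hr
  refine (hT.comm_iff hc hA hr).2 ⟨k, hk, (TA.inCommitted_congr ?_).1 hK⟩
  exact PVal.override_of_mem (hr.1 ▸ W_subset_netW hk TA.loc_mem_W)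

theorem comm_restrict_iff (hT : Represents T A J)
    (hc : Pairwise fun i j => (A i).Compatible (A j)) (hA : ∀ i, (A i).Composable)
    (hv : v ∈ netStates A J₂) (hJ : J ⊆ J₂) :
    T.Comm (v.restrict (netW A J)) ↔ ∃ k ∈ J, (A k).InCommitted v := by
  rw [hT.comm_iff hc hA (restrict_mem_netStates hv hJ)]
  refine exists_congr fun k => and_congr_right fun hk => TA.inCommitted_congr ?_
  exact PVal.restrict_of_mem (W_subset_netW hk TA.loc_mem_W)

theorem splitStep_of_parStep (hT₁ : Represents T₁ A J₁) (hT₂ : Represents T₂ A J₂)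
    (hc : Pairwise fun i j => (A i).Compatible (A j)) (hA : ∀ i, (A i).Composable)
    (hJ : Disjoint J₁ J₂) (h : TTSB.ParStep T₁ T₂ b v (.disc a) v') :
    v ∈ netStates A (J₁ ∪ J₂) ∧ SplitStep A J₁ J₂ b v a v' := by
  have hmem {r s : PVal X D} (hr : r ∈ T₁.S) (hs : s ∈ T₂.S) (hrs : r.Compat s) :
      r.override s ∈ netStates A (J₁ ∪ J₂) :=
    override_mem_netStates (hT₁.S_eq ▸ hr) (hT₂.S_eq ▸ hs) hrs
  cases h with
  | ext hr hs hrs ha h => exact ⟨hmem hr hs hrs, .ext ha (hT₁.netStep_override h _)⟩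
  | @tau r s _ _ hr hs hrs h hb =>
    refine ⟨hmem hr hs hrs, .tau (hT₁.netStep_override h _) fun k hk hK => hb ?_⟩
    exact hT₂.comm_of_inCommitted hc hA hs r hk (hrs.override_comm ▸ hK)
  | @sync r s r' s' _ _ c hr hs hrs h h' hb =>
    have h₂ := hT₂.netStep_override h' r'
    rw [PVal.update_override] at h₂
    refine ⟨hmem hr hs hrs, .sync (hT₁.netStep_override h _) h₂ fun k hk hK => hb ?_⟩
    exact hk.imp (hT₁.comm_of_inCommitted hc hA hr s · hK)
      (hT₂.comm_of_inCommitted hc hA hs r · (hrs.override_comm ▸ hK))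
  | @snd r s r' s' _ _ δ hr hs hrs h h' hrs' =>
    have h₂ := hT₂.netStep_override h' r'
    rw [PVal.update_override, ← hrs'.override_comm] at h₂
    exact ⟨hmem hr hs hrs, .snd (hT₁.netStep_override h _) h₂⟩
  | @rcv r s r' s' _ _ δ hr hs hrs h h' hrs' =>
    have hstep := (hT₁.disc_iff.1 h).2
    have hs_mem : s ∈ netStates A J₂ := hT₂.S_eq ▸ hs
    have hsr' : s.Compat r' := fun x hx => by
      rw [PVal.eq_of_restrict_eq (hstep.restrict_eq_of_brecv hc hA hJ) (hs_mem.1 ▸ hx.1)]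
      exact (hrs x ⟨hstep.dom_eq ▸ hx.2, hx.1⟩).symm
    have h₂ := hT₂.netStep_override h' r'
    rw [hsr'.override_comm, ← hrs'.override_comm] at h₂
    exact ⟨hmem hr hs hrs, .rcv (hT₁.netStep_override h _) h₂⟩

theorem parStep_of_csend_crecv {c : C} (hT₁ : Represents T₁ A J₁) (hT₂ : Represents T₂ A J₂)
    (hc : Pairwise fun i j => (A i).Compatible (A j)) (hA : ∀ i, (A i).Composable)
    (hv : v ∈ netStates A (J₁ ∪ J₂)) (h : NetStep A J₁ b v (.csend c) w)
    (h' : NetStep A J₂ b' w (.crecv c) v')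
    (hb : ∀ k ∈ J₁ ∪ J₂, (A k).InCommitted v → (b || b') = true) :
    TTSB.ParStep T₁ T₂ (b || b') v (.disc .tau) v' := by
  have hl : J₁ ⊆ J₁ ∪ J₂ := Set.subset_union_left
  have hr : J₂ ⊆ J₁ ∪ J₂ := Set.subset_union_right
  have hdom : v.dom = netW A J₁ ∪ netW A J₂ := hv.1.trans netW_union
  have hdom' : w.dom = netW A J₂ ∪ netW A J₁ := h.dom_eq.trans (hdom.trans (Set.union_comm _ _))
  have h₂ := hT₂.tr_restrict h' (h.mem_netStates hc hA hv) hr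
  rw [← h.restrict_update_restrict hdom] at h₂
  have hstep := TTSB.ParStep.sync (hT₁.restrict_mem hv hl) (hT₂.restrict_mem hv hr)
    (PVal.compat_restrict_restrict v _ _) (hT₁.tr_restrict h hv hl) h₂ ?_
  · rwa [restrict_override_restrict_netW hv, h'.restrict_override_restrict hdom'] at hstep
  · rw [hT₁.comm_restrict_iff hc hA hv hl, hT₂.comm_restrict_iff hc hA hv hr]
    rintro (⟨k, hk, hK⟩ | ⟨k, hk, hK⟩)
    · exact hb k (.inl hk) hK
    · exact hb k (.inr hk) hK

theorem parStep_of_splitStep (hT₁ : Represents T₁ A J₁) (hT₂ : Represents T₂ A J₂)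
    (hc : Pairwise fun i j => (A i).Compatible (A j)) (hA : ∀ i, (A i).Composable)
    (hJ : Disjoint J₁ J₂) (hv : v ∈ netStates A (J₁ ∪ J₂)) (h : SplitStep A J₁ J₂ b v a v') :
    TTSB.ParStep T₁ T₂ b v (.disc a) v' := by
  have hl : J₁ ⊆ J₁ ∪ J₂ := Set.subset_union_left
  have hr : J₂ ⊆ J₁ ∪ J₂ := Set.subset_union_right
  have hmem₁ := hT₁.restrict_mem hv hl
  have hmem₂ := hT₂.restrict_mem hv hr
  have hcompat := PVal.compat_restrict_restrict v (netW A J₁) (netW A J₂)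
  have hdom : v.dom = netW A J₁ ∪ netW A J₂ := hv.1.trans netW_union
  have hmerge := restrict_override_restrict_netW hv
  cases h with
  | ext ha h =>
    have hstep := TTSB.ParStep.ext hmem₁ hmem₂ hcompat ha (hT₁.tr_restrict h hv hl)
    rwa [hmerge, h.restrict_override_restrict hdom] at hstep
  | tau h hb =>
    have hstep := TTSB.ParStep.tau hmem₁ hmem₂ hcompat (hT₁.tr_restrict h hv hl)
      fun hK => ((hT₂.comm_restrict_iff hc hA hv hr).1 hK).elim fun k hk => hb k hk.1 hk.2
    rwa [hmerge, h.restrict_override_restrict hdom] at hstep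
  | sync h h' hb => exact hT₁.parStep_of_csend_crecv hT₂ hc hA hv h h' hb
  | snd h h' =>
    have hw := h.mem_netStates hc hA hv
    have h₁ := hT₁.tr_restrict h hv hl
    have h₂ := hT₂.tr_restrict h' hw hr
    rw [← h.restrict_update_restrict hdom, ← h'.restrict_eq_of_brecv hc hA hJ.symm] at h₂
    rw [← h'.restrict_eq_of_brecv hc hA hJ.symm] at h₁
    have hstep := TTSB.ParStep.snd hmem₁ hmem₂ hcompat h₁ h₂ (PVal.compat_restrict_restrict _ _ _)
    rwa [hmerge, restrict_override_restrict_netW (h'.mem_netStates hc hA hw)] at hstep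
  | rcv h h' =>
    have hw := h.mem_netStates hc hA hv
    have h₁ := hT₁.tr_restrict h hv hl
    have h₂ := hT₂.tr_restrict h' hw hr
    rw [← h'.restrict_eq_of_brecv hc hA hJ.symm] at h₁
    rw [h.restrict_eq_of_brecv hc hA hJ] at h₂
    have hstep := TTSB.ParStep.rcv hmem₁ hmem₂ hcompat h₁ h₂ (PVal.compat_restrict_restrict _ _ _)
    rwa [hmerge, restrict_override_restrict_netW (h'.mem_netStates hc hA hw)] at hstep

theorem parStep_delay_iff (hT₁ : Represents T₁ A J₁) (hT₂ : Represents T₂ A J₂) :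
    TTSB.ParStep T₁ T₂ b v (.delay d) v' ↔
      v ∈ netStates A (J₁ ∪ J₂) ∧ b = false ∧ DelayStep A (J₁ ∪ J₂) d v v' := by
  constructor
  · rintro (_ | _ | _ | ⟨hr, hs, hrs, h₁, h₂, -⟩)
    obtain ⟨hr, -, rfl, h₁⟩ := hT₁.delay_iff.1 h₁
    obtain ⟨hs, -, rfl, h₂⟩ := hT₂.delay_iff.1 h₂
    rw [← PVal.delay_override]
    refine ⟨override_mem_netStates hr hs hrs, rfl, rfl, ?_⟩
    rintro i (hi | hi)
    · refine (TA.localStep_delay_congr fun x hx => PVal.override_of_mem ?_).2 (h₁ i hi)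
      exact hr.1 ▸ W_subset_netW hi hx
    · rw [hrs.override_comm]
      refine (TA.localStep_delay_congr fun x hx => PVal.override_of_mem ?_).2 (h₂ i hi)
      exact hs.1 ▸ W_subset_netW hi hx
  · rintro ⟨hv, rfl, rfl, h⟩
    have hr : v.restrict (netW A J₁) ∈ netStates A J₁ :=
      restrict_mem_netStates hv Set.subset_union_left
    have hs : v.restrict (netW A J₂) ∈ netStates A J₂ :=
      restrict_mem_netStates hv Set.subset_union_right
    have hrestrict {J i} (hi : i ∈ J) := TA.localStep_delay_congr (A := A i) (b := false) (d := d)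
      fun x hx => PVal.restrict_of_mem (f := v) (W_subset_netW hi hx)
    have hstep := TTSB.ParStep.time (hT₁.S_eq ▸ hr) (hT₂.S_eq ▸ hs)
      (PVal.compat_restrict_restrict v _ _)
      (hT₁.delay_iff.2 ⟨hr, rfl, rfl, fun i hi => (hrestrict hi).2 (h i (.inl hi))⟩)
      (hT₂.delay_iff.2 ⟨hs, rfl, rfl, fun i hi => (hrestrict hi).2 (h i (.inr hi))⟩)
      (by rw [PVal.restrict_delay, PVal.restrict_delay]; exact PVal.compat_restrict_restrict _ _ _)
    rwa [← PVal.delay_override, restrict_override_restrict_netW hv] at hstep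

theorem par (hT₁ : Represents T₁ A J₁) (hT₂ : Represents T₂ A J₂)
    (hc : Pairwise fun i j => (A i).Compatible (A j)) (hA : ∀ i, (A i).Composable)
    (hJ : Disjoint J₁ J₂) : Represents (T₁.par T₂) A (J₁ ∪ J₂) where
  S_eq := by
    ext v
    constructor
    · rintro ⟨r, hr, s, hs, hrs, rfl⟩
      exact override_mem_netStates (hT₁.S_eq ▸ hr) (hT₂.S_eq ▸ hs) hrs
    · intro hv
      exact ⟨_, hT₁.restrict_mem hv Set.subset_union_left, _,
        hT₂.restrict_mem hv Set.subset_union_right, PVal.compat_restrict_restrict v _ _,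
        (restrict_override_restrict_netW hv).symm⟩
  disc_iff := by
    intro b v a v'
    rw [netStep_union_iff hc hA hJ]
    constructor
    · rintro (h | h)
      · exact (hT₁.splitStep_of_parStep hT₂ hc hA hJ h).imp_right .inl
      · rw [Set.union_comm]
        exact (hT₂.splitStep_of_parStep hT₁ hc hA hJ.symm h).imp_right .inr
    · rintro ⟨hv, h | h⟩
      · exact .inl (hT₁.parStep_of_splitStep hT₂ hc hA hJ hv h)
      · exact .inr (hT₂.parStep_of_splitStep hT₁ hc hA hJ.symm (Set.union_comm _ _ ▸ hv) h)
  delay_iff := by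
    intro b v d v'
    refine (or_congr (parStep_delay_iff hT₁ hT₂) (parStep_delay_iff hT₂ hT₁)).trans ?_
    rw [Set.union_comm J₂ J₁, or_self]

end Represents

theorem represents_singleton (A : ι → TA X D Δ C) (i : ι) : Represents (A i).ttsb A {i} where
  S_eq := netStates_singleton.symm
  disc_iff := by
    intro b v a v'
    rw [netStep_singleton, netStates_singleton]
    constructor
    · intro h
      have hv : v.dom = (A i).W := h.source_mem.1
      have hv' : v'.dom = (A i).W := h.target_mem.1
      refine ⟨h.source_mem, (TA.localStep_iff_step hv hv').2 h, fun x hx => ?_⟩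
      exact (PVal.notMem_dom.1 (hv'.symm ▸ hx)).trans (PVal.notMem_dom.1 (hv.symm ▸ hx)).symm
    · rintro ⟨hv, h⟩
      exact (TA.localStep_iff_step hv.1 (h.dom_eq.trans hv.1)).1 h.1
  delay_iff := by
    intro b v d v'
    rw [netStates_singleton]
    simp only [DelayStep, Set.mem_singleton_iff, forall_eq]
    constructor
    · intro h
      have hstep := (TA.localStep_iff_step h.source_mem.1 h.target_mem.1).2 h
      have hv' : v' = v.delay d := by cases h; assumption
      subst hv'
      obtain ⟨rfl, -⟩ := TA.localStep_delay_iff.1 hstep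
      exact ⟨h.source_mem, rfl, rfl, hstep⟩
    · rintro ⟨hv, rfl, rfl, h⟩
      exact (TA.localStep_iff_step hv.1 ((PVal.delay_dom v d).trans hv.1)).1 h

theorem represents_parAll (hc : Pairwise fun i j => (A i).Compatible (A j))
    (hA : ∀ i, (A i).Composable) : ∀ {n : ℕ} (f : Fin (n + 1) → ι), Function.Injective f →
    Represents (TTSB.parAll fun i => (A (f i)).ttsb) A (Set.range f)
  | 0, f, _ => by
    have hrange : Set.range f = {f 0} := Set.range_unique (ι := Fin 1)
    rw [hrange]
    exact represents_singleton A (f 0)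
  | n + 1, f, hf => by
    have hrange : Set.range f = Set.range (fun i : Fin (n + 1) => f i.castSucc) ∪
        {f (Fin.last _)} := by
      ext x
      simp only [Set.mem_range, Set.mem_union, Fin.exists_fin_succ', Set.mem_singleton_iff,
        eq_comm (a := x)]
    rw [hrange]
    refine (represents_parAll hc hA _ (hf.comp (Fin.castSucc_injective _))).par
      (represents_singleton A _) hc hA ?_
    rw [Set.disjoint_singleton_right]
    rintro ⟨i, hi⟩
    exact (Fin.castSucc_lt_last i).ne (hf hi)

/-! ### Iterated updates -/

/-- The valuation of the location variables of the members of `L` with values `l'`. -/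
noncomputable def locVals (A : ι → TA X D Δ C) (l' : ∀ k, D (A k).loc) (L : List ι) : PVal X D :=
  L.foldr (fun k f => ((A k).locVal (l' k)).override f) PVal.empty

/-- The valuation reached from `s` when the members of `L` take, one after the other, transitions
with update functions `ρ` and target locations `l'`. -/
noncomputable def postAll (A : ι → TA X D Δ C) (ρ : ι → PVal X D → PVal X D)
    (l' : ∀ k, D (A k).loc) (L : List ι) (s : PVal X D) : PVal X D :=
  L.foldl (fun t k => (A k).post (ρ k) (l' k) t) s

section IteratedUpdate

variable {l l' : ∀ k, D (A k).loc} {g : ι → Set (PVal X D)} {ρ : ι → PVal X D → PVal X D}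
  {L : List ι} {s : PVal X D}

theorem postAll_update [DecidableEq ι] (hi : i ∉ L) (σ : PVal X D → PVal X D) (m : D (A i).loc) :
    postAll A (Function.update ρ i σ) (Function.update l' i m) L s = postAll A ρ l' L s :=
  List.foldl_ext _ _ _ fun t j hj => by
    simp only [Function.update_of_ne (ne_of_mem_of_not_mem hj hi)]

theorem foldl_apply_update_locVals (hc : Pairwise fun i j => (A i).Compatible (A j)) {f : PVal X D}
    (hnodup : L.Nodup) (htr : ∀ k ∈ L, (A k).tr (l k) (g k) a (ρ k) (l' k))
    (hs : ∀ k ∈ L, (A k).V ⊆ s.dom) (hf : ∀ k ∈ L, Disjoint f.dom (A k).W) :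
    (L.foldl (fun t k => (A k).apply (ρ k) t) s).update (f.override (locVals A l' L)) =
      postAll A ρ l' L (s.update f) := by
  induction L generalizing s f with
  | nil => rw [locVals, List.foldr_nil, PVal.override_empty]; rfl
  | cons i L ih =>
    simp only [List.nodup_cons, List.forall_mem_cons] at hnodup htr hs hf
    have hf' : ∀ k ∈ L, Disjoint (f.override ((A i).locVal (l' i))).dom (A k).W := fun k hk => by
      rw [PVal.override_dom, TA.locVal_dom, Set.disjoint_union_left, Set.disjoint_singleton_left]
      exact ⟨hf.2 k hk, (hc (ne_of_mem_of_not_mem hk hnodup.1).symm).loc_notMem_W⟩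
    rw [locVals, List.foldr_cons, ← locVals, ← PVal.override_assoc, List.foldl_cons,
      ih hnodup.2 htr.2 (by simpa only [TA.apply_dom] using hs.2) hf',
      TA.update_override_locVal htr.1 hs.1 hf.1, postAll, postAll, List.foldl_cons]

theorem postAll_of_notMem (hA : ∀ i, (A i).Composable)
    (htr : ∀ k ∈ L, (A k).tr (l k) (g k) (.brecv δ) (ρ k) (l' k)) (hs : ∀ k ∈ L, (A k).W ⊆ s.dom)
    (hx : ∀ k ∈ L, x ∈ (A k).W → x ∈ (A k).E) : postAll A ρ l' L s x = s x := by
  induction L generalizing s with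
  | nil => rfl
  | cons i L ih =>
    simp only [List.forall_mem_cons] at htr hs hx
    rw [postAll, List.foldl_cons, ← postAll,
      ih htr.2 (by simpa only [TA.post_dom] using hs.2) hx.2]
    by_cases hxi : x ∈ (A i).W
    · exact (hA i).post_of_mem_E htr.1 hs.1 (hx.1 hxi)
    · exact TA.post_of_notMem_W htr.1 hs.1 hxi

theorem postAll_of_mem (hc : Pairwise fun i j => (A i).Compatible (A j))
    (hA : ∀ i, (A i).Composable) (hnodup : L.Nodup)
    (htr : ∀ k ∈ L, (A k).tr (l k) (g k) (.brecv δ) (ρ k) (l' k)) (hs : ∀ k ∈ L, (A k).W ⊆ s.dom)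
    (hj : j ∈ L) (hx : x ∈ (A j).W) : postAll A ρ l' L s x = (A j).post (ρ j) (l' j) s x := by
  induction L generalizing s with
  | nil => cases hj
  | cons i L ih =>
    have htrj := htr j hj
    have hsj := hs j hj
    simp only [List.nodup_cons, List.forall_mem_cons] at hnodup htr hs
    have hs' : ∀ k ∈ L, (A k).W ⊆ ((A i).post (ρ i) (l' i) s).dom := by
      simpa only [TA.post_dom] using hs.2
    rw [postAll, List.foldl_cons, ← postAll]
    rcases List.mem_cons.1 hj with rfl | hjL
    · exact postAll_of_notMem hA htr.2 hs' fun k hk hxk =>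
        (hc (ne_of_mem_of_not_mem hk hnodup.1)).mem_E hxk hx
    · rw [ih hnodup.2 htr.2 hs' hjL]
      refine TA.post_congr htrj (hs' j hjL) hsj (fun y hy => ?_) hx
      by_cases hyi : y ∈ (A i).W
      · exact (hA i).post_of_mem_E htr.1 hs.1
          ((hc (ne_of_mem_of_not_mem hjL hnodup.1).symm).mem_E hyi hy)
      · exact TA.post_of_notMem_W htr.1 hs.1 hyi

theorem receiveStep_postAll (hc : Pairwise fun i j => (A i).Compatible (A j))
    (hA : ∀ i, (A i).Composable) (hnodup : L.Nodup)
    (hL : ∀ j, j ∈ L ↔ j ∈ J ∧ (A j).CanReceive δ w)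
    (hen : ∀ j ∈ L, (A j).Enabled w (l j) (g j) (.brecv δ) (ρ j) (l' j))
    (hw : ∀ j ∈ J, (A j).Legal w) (hpost : ∀ j ∈ J, (A j).Legal (postAll A ρ l' L w))
    (hb : b = true ↔ ∃ j ∈ L, l j ∈ (A j).K) :
    ReceiveStep A J b w δ (postAll A ρ l' L w) := by
  have hLJ : ∀ j ∈ L, j ∈ J := fun j hj => ((hL j).1 hj).1
  have htr : ∀ j ∈ L, (A j).tr (l j) (g j) (.brecv δ) (ρ j) (l' j) := fun j hj => (hen j hj).1
  have hdom : ∀ j ∈ L, (A j).W ⊆ w.dom := fun j hj => (hw j (hLJ j hj)).subset_dom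
  have hstep : ∀ j ∈ L, ∀ b' : Bool, (b' = true ↔ l j ∈ (A j).K) →
      (A j).LocalStep b' w (.disc (.brecv δ)) (postAll A ρ l' L w) := fun j hj b' hb' =>
    (hen j hj).localStep hb' (hw j (hLJ j hj)) (hpost j (hLJ j hj))
      fun x hx => postAll_of_mem hc hA hnodup htr hdom hj hx
  refine ⟨fun j hj => ?_, fun x hx => ?_, hb.trans ⟨?_, ?_⟩⟩
  · by_cases hjL : j ∈ L
    · classical exact ⟨_, hstep j hjL (decide (l j ∈ (A j).K)) decide_eq_true_iff⟩
    · refine ⟨false, TA.localStep_of_not_canReceive (fun h => hjL ((hL j).2 ⟨hj, h⟩)) (hw j hj)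
        fun x hx => postAll_of_notMem hA htr hdom fun k hk hxk => ?_⟩
      exact (hc (ne_of_mem_of_not_mem hk hjL)).mem_E hxk hx
  · exact postAll_of_notMem hA htr hdom fun k hk hxk => (hx (W_subset_netW (hLJ k hk) hxk)).elim
  · rintro ⟨j, hj, hK⟩
    exact ⟨j, hLJ j hj, hstep j hj true (iff_of_true rfl hK)⟩
  · rintro ⟨j, hj, h⟩
    have hjL := (hL j).2 ⟨hj, (h.flag_iff.1 rfl).2 δ rfl⟩
    exact ⟨j, hjL, (hen j hjL).2.1.inCommitted_iff.1 h.inCommitted⟩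

theorem ReceiveStep.flag_iff (h : ReceiveStep A J b v δ v') :
    b = true ↔ ∃ j ∈ J, (A j).CanReceive δ v ∧ (A j).InCommitted v := by
  refine h.flag.trans (exists_congr fun j => and_congr_right fun hj => ?_)
  constructor
  · intro hstep
    exact ⟨(hstep.flag_iff.1 rfl).2 δ rfl, hstep.inCommitted⟩
  · rintro ⟨hrecv, hK⟩
    obtain ⟨b', hstep⟩ := h.step j hj
    obtain rfl : b' = true := hstep.flag_iff.2 ⟨hK, fun _ hδ => by cases hδ; exact hrecv⟩
    exact hstep

theorem ReceiveStep.eq_of_not_canReceive (h : ReceiveStep A J b v δ v') (hj : j ∈ J)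
    (hn : ¬ (A j).CanReceive δ v) (hx : x ∈ (A j).W) : v' x = v x := by
  obtain ⟨b', hstep⟩ := h.step j hj
  rcases hstep.disc_cases with ⟨l, g, ρ, l', ⟨htr, hl, hg⟩, -⟩ | ⟨-, -, -, -, hvv'⟩
  · exact absurd ⟨l, g, ρ, l', htr, hl, hg⟩ hn
  · exact hvv' x hx

theorem ReceiveStep.exists_eq_postAll (h : ReceiveStep A J b w δ v')
    (hc : Pairwise fun i j => (A i).Compatible (A j)) (hA : ∀ i, (A i).Composable)
    (hnodup : L.Nodup) (hL : ∀ j, j ∈ L ↔ j ∈ J ∧ (A j).CanReceive δ w) :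
    ∃ (l l' : ∀ k, D (A k).loc) (g : ι → Set (PVal X D)) (ρ : ι → PVal X D → PVal X D),
      (∀ j ∈ L, (A j).Enabled w (l j) (g j) (.brecv δ) (ρ j) (l' j)) ∧
      (b = true ↔ ∃ j ∈ L, l j ∈ (A j).K) ∧ v' = postAll A ρ l' L w := by
  have hex : ∀ j, ∃ (l : D (A j).loc) (g : Set (PVal X D)) (ρ : PVal X D → PVal X D)
      (l' : D (A j).loc), j ∈ L → (A j).Enabled w l g (.brecv δ) ρ l' ∧
        ∀ x ∈ (A j).W, v' x = (A j).post ρ l' w x := by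
    intro j
    by_cases hj : j ∈ L
    · obtain ⟨hjJ, hrecv⟩ := (hL j).1 hj
      obtain ⟨b', hstep⟩ := h.step j hjJ
      rcases hstep.disc_cases with ⟨l, g, ρ, l', hen, -, hpost⟩ | ⟨_, hδ, hn, -⟩
      · exact ⟨l, g, ρ, l', fun _ => ⟨hen, hpost⟩⟩
      · cases hδ
        exact absurd hrecv hn
    · exact ⟨(A j).l0, ∅, id, (A j).l0, fun h => absurd h hj⟩
  choose l g ρ l' hrcv using hex
  have htr : ∀ j ∈ L, (A j).tr (l j) (g j) (.brecv δ) (ρ j) (l' j) := fun j hj => (hrcv j hj).1.1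
  have hdom : ∀ j ∈ L, (A j).W ⊆ w.dom := fun j hj =>
    (h.step j ((hL j).1 hj).1).choose_spec.legal_source.subset_dom
  refine ⟨l, l', g, ρ, fun j hj => (hrcv j hj).1, h.flag_iff.trans ?_, funext fun x => ?_⟩
  · simp only [← and_assoc, ← hL]
    exact exists_congr fun j => and_congr_right fun hj => (hrcv j hj).1.2.1.inCommitted_iff
  · by_cases hx : ∃ j ∈ L, x ∈ (A j).W
    · obtain ⟨j, hj, hxj⟩ := hx
      rw [(hrcv j hj).2 x hxj, postAll_of_mem hc hA hnodup htr hdom hj hxj]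
    · rw [postAll_of_notMem hA htr hdom fun k hk hxk => (hx ⟨k, hk, hxk⟩).elim]
      by_cases hxJ : x ∈ netW A J
      · obtain ⟨j, hj, hxj⟩ := mem_netW.1 hxJ
        exact h.eq_of_not_canReceive hj (fun hrecv => hx ⟨j, (hL j).2 ⟨hj, hrecv⟩, hxj⟩) hxj
      · exact h.frame x hxJ

end IteratedUpdate

end Subnetwork

/-! ### Networks -/

/-- The transitions of the subnetwork with index set `J` that remain when all channels are
restricted: internal transitions, delays, and broadcasts, which become internal if they respect
the priority of committed locations. -/
inductive ClosedStep {ι : Type*} (A : ι → TA X D Δ C) (J : Set ι) :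
    PVal X D → Act Δ C → PVal X D → Prop
  | tau {b : Bool} {v v' : PVal X D} : NetStep A J b v .tau v' → ClosedStep A J v (.disc .tau) v'
  | bcst {b : Bool} {v v' : PVal X D} {δ : Δ} : NetStep A J b v (.bsend δ) v' →
      (∀ k ∈ J, (A k).InCommitted v → b = true) → ClosedStep A J v (.disc .tau) v'
  | delay {v v' : PVal X D} {d : ℝ≥0} : DelayStep A J d v v' → ClosedStep A J v (.delay d) v'

namespace NTA

variable {n : ℕ} {N : NTA X D Δ C n} {s t w : PVal X D} {b : Bool} {a : DAct Δ C} {δ : Δ}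
  {α : Act Δ C} {i : Fin (n + 1)}

theorem pairwise_compatible (N : NTA X D Δ C n) :
    Pairwise fun i j => (N.A i).Compatible (N.A j) := fun i j => N.compat i j

theorem netStates_univ : netStates N.A Set.univ = N.states := by
  ext v
  rw [netStates, netW, Set.biUnion_univ, states]
  refine and_congr_right fun hv => ?_
  simp only [Set.mem_univ, true_implies]
  refine forall_congr' fun i => TA.legal_iff ?_
  rw [hv]
  exact Set.subset_iUnion (fun i => (N.A i).W) i

theorem legal_of_mem_states (hs : s ∈ N.states) (i : Fin (n + 1)) : (N.A i).Legal s :=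
  (netStates_univ.symm.le hs).2 i trivial

theorem noCommitted_or_iff {p : Prop} (hb : b = true ↔ p) :
    (∀ k ∈ Set.univ, (N.A k).InCommitted s → b = true) ↔ N.NoCommitted s ∨ p := by
  rw [NoCommitted, ← not_exists, ← imp_iff_not_or, ← hb, forall_exists_index]
  simp only [Set.mem_univ, true_implies]

theorem RSlist_nodup : (N.RSlist δ i s).Nodup := (List.nodup_finRange _).filter _

theorem mem_RSlist {j : Fin (n + 1)} : j ∈ N.RSlist δ i s ↔ j ∈ N.RS δ i s := by
  simp only [RSlist, List.mem_filter, List.mem_finRange, decide_eq_true_iff, true_and]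

theorem mem_RSlist_iff_canReceive (hA : ∀ i, (N.A i).Composable) (hs : s ∈ N.states)
    (h : (N.A i).FrameStep b s a w) (j : Fin (n + 1)) :
    j ∈ N.RSlist δ i s ↔ j ∈ Set.univ \ {i} ∧ (N.A j).CanReceive δ w := by
  have hmem : j ∈ Set.univ \ {i} ↔ i ≠ j := by
    simp only [Set.mem_sdiff, Set.mem_univ, true_and, Set.mem_singleton_iff, ne_comm (a := i),
      ne_eq]
  rw [mem_RSlist, hmem]
  exact and_congr_right fun hij => (h.canReceive_iff (N.compat j i hij.symm) (hA j)
    (legal_of_mem_states hs j).subset_dom).symm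

theorem bcst_target_eq_postAll {l l' : ∀ k, D (N.A k).loc} {g : Fin (n + 1) → Set (PVal X D)}
    {ρ : Fin (n + 1) → PVal X D → PVal X D} {L : List (Fin (n + 1))} (hs : s ∈ N.states)
    (hnodup : (i :: L).Nodup) (htr : ∀ k ∈ L, (N.A k).tr (l k) (g k) a (ρ k) (l' k)) :
    (L.foldl (fun t j => (N.A j).apply (ρ j) t) ((N.A i).apply (ρ i) s)).update
        ((i :: L).foldr (fun k f => ((N.A k).locVal (l' k)).override f) PVal.empty) =
      postAll N.A ρ l' L ((N.A i).post (ρ i) (l' i) s) := by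
  rw [List.nodup_cons] at hnodup
  refine foldl_apply_update_locVals N.pairwise_compatible hnodup.2 htr (fun k _ => ?_)
    fun k hk => ?_
  · rw [TA.apply_dom]
    exact TA.V_subset_W.trans (legal_of_mem_states hs k).subset_dom
  · rw [TA.locVal_dom, Set.disjoint_singleton_left]
    exact (N.compat i k (ne_of_mem_of_not_mem hk hnodup.1).symm).loc_notMem_W

theorem sync_target_eq_post {j : Fin (n + 1)} {l' : D (N.A i).loc} {m m' : D (N.A j).loc}
    {g : Set (PVal X D)} {ρ σ : PVal X D → PVal X D} (hs : s ∈ N.states) (hij : i ≠ j)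
    (htr : (N.A j).tr m g a σ m') :
    ((N.A j).apply σ ((N.A i).apply ρ s)).update
        (((N.A i).locVal l').override ((N.A j).locVal m')) =
      (N.A j).post σ m' ((N.A i).post ρ l' s) := by
  refine TA.update_override_locVal htr ?_ ?_
  · rw [TA.apply_dom]
    exact TA.V_subset_W.trans (legal_of_mem_states hs j).subset_dom
  · rw [TA.locVal_dom, Set.disjoint_singleton_left]
    exact (N.compat i j hij).loc_notMem_W

theorem delayStep_iff {d : ℝ≥0} (hs : s ∈ N.states) (ht : t ∈ N.states) :
    DelayStep N.A Set.univ d s t ↔ t = s.delay d ∧ N.NoCommitted s ∧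
      ¬ ∃ i l g ρ l', (N.A i).urgent l g .tau ρ l' ∧ (N.A i).At s l ∧ Holds (N.A i).V g s := by
  refine and_congr_right fun hst => ?_
  subst hst
  simp only [TA.localStep_delay_iff, legal_of_mem_states hs, legal_of_mem_states ht, Set.mem_univ,
    true_implies, true_and, forall_and, NoCommitted, not_exists]

open Classical in
theorem closedStep_of_sync (hA : ∀ i, (N.A i).Composable) {j : Fin (n + 1)} {c : C}
    {l l' : D (N.A i).loc} {m m' : D (N.A j).loc} {g h : Set (PVal X D)}
    {ρ σ : PVal X D → PVal X D} (hs : s ∈ N.states) (ht : t ∈ N.states) (hij : i ≠ j)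
    (hi : (N.A i).Enabled s l g (.csend c) ρ l') (hj : (N.A j).Enabled s m h (.crecv c) σ m')
    (hst : t = (N.A j).post σ m' ((N.A i).post ρ l' s))
    (hK : N.NoCommitted s ∨ l ∈ (N.A i).K ∨ m ∈ (N.A j).K) :
    ClosedStep N.A Set.univ s (.disc .tau) t := by
  subst hst
  have hdom : ∀ k, (N.A k).W ⊆ ((N.A i).post ρ l' s).dom := fun k => by
    rw [TA.post_dom]
    exact (legal_of_mem_states hs k).subset_dom
  have hlegal : (N.A i).Legal ((N.A i).post ρ l' s) :=
    (hA i).legal_of_eq_off_E (legal_of_mem_states ht i) (hdom i) fun x hx hxE =>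
      TA.post_of_notMem_W hj.1 (hdom j) fun hxj => hxE ((N.compat i j hij).mem_E hx hxj)
  have hsend := hi.frameStep (decide_eq_true_iff (p := l ∈ (N.A i).K)) (legal_of_mem_states hs i)
    hlegal
  have hrecv := ((hsend.enabled_input_iff (N.compat j i hij.symm) (hA j)
      (legal_of_mem_states hs j).subset_dom (.inr ⟨c, rfl⟩)).2 hj).frameStep
    (decide_eq_true_iff (p := m ∈ (N.A j).K))
    (hsend.legal (N.compat j i hij.symm) (hA j) (legal_of_mem_states hs j))
    (legal_of_mem_states ht j)
  exact .tau (.sync trivial trivial hij hsend hrecv ((noCommitted_or_iff (by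
    simp only [Bool.or_eq_true, decide_eq_true_iff])).2 hK))

open Classical in
theorem closedStep_of_bcst (hA : ∀ i, (N.A i).Composable) {l l' : ∀ k, D (N.A k).loc}
    {g : Fin (n + 1) → Set (PVal X D)} {ρ : Fin (n + 1) → PVal X D → PVal X D}
    (hs : s ∈ N.states) (ht : t ∈ N.states)
    (hi : (N.A i).Enabled s (l i) (g i) (.bsend δ) (ρ i) (l' i))
    (hrecv : ∀ j ∈ N.RS δ i s, (N.A j).Enabled s (l j) (g j) (.brecv δ) (ρ j) (l' j))
    (hst : t = postAll N.A ρ l' (N.RSlist δ i s) ((N.A i).post (ρ i) (l' i) s))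
    (hK : N.NoCommitted s ∨ l i ∈ (N.A i).K ∨ ∃ j ∈ N.RS δ i s, l j ∈ (N.A j).K) :
    ClosedStep N.A Set.univ s (.disc .tau) t := by
  subst hst
  simp only [← mem_RSlist] at hrecv hK
  have hdom : ∀ k, (N.A k).W ⊆ ((N.A i).post (ρ i) (l' i) s).dom := fun k => by
    rw [TA.post_dom]
    exact (legal_of_mem_states hs k).subset_dom
  have hlegal : (N.A i).Legal ((N.A i).post (ρ i) (l' i) s) :=
    (TA.legal_congr fun x hx => postAll_of_notMem hA (fun k hk => (hrecv k hk).1)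
      (fun k _ => hdom k) fun k hk hxk =>
        (N.compat k i (mem_RSlist.1 hk).1.symm).mem_E hxk hx).1 (legal_of_mem_states ht i)
  have hsend := hi.frameStep (decide_eq_true_iff (p := l i ∈ (N.A i).K))
    (legal_of_mem_states hs i) hlegal
  have hreceive := receiveStep_postAll N.pairwise_compatible hA RSlist_nodup
    (mem_RSlist_iff_canReceive hA hs hsend)
    (fun j hj => (hsend.enabled_input_iff (N.compat j i (mem_RSlist.1 hj).1.symm) (hA j)
      (legal_of_mem_states hs j).subset_dom (.inl ⟨δ, rfl⟩)).2 (hrecv j hj))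
    (fun j _ => hsend.legal_all N.pairwise_compatible hA (legal_of_mem_states hs j))
    (fun j _ => legal_of_mem_states ht j) decide_eq_true_iff
  exact .bcst (.snd trivial hsend hreceive) ((noCommitted_or_iff (by
    simp only [Bool.or_eq_true, decide_eq_true_iff])).2 hK)

open Classical in
theorem closedStep_of_step (hA : ∀ i, (N.A i).Composable) (hs : s ∈ N.states) (ht : t ∈ N.states)
    (h : N.Step s α t) : ClosedStep N.A Set.univ s α t := by
  cases h with
  | tau htr hl hg hst hK =>
    subst hst
    exact .tau (.tau trivial (TA.Enabled.frameStep ⟨htr, hl, hg⟩ decide_eq_true_iff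
      (legal_of_mem_states hs _) (legal_of_mem_states ht _))
      ((noCommitted_or_iff decide_eq_true_iff).2 hK))
  | sync hij htr hl hg htr' hl' hg' hst hK =>
    exact closedStep_of_sync hA hs ht hij ⟨htr, hl, hg⟩ ⟨htr', hl', hg'⟩
      (hst.trans (sync_target_eq_post hs hij htr')) hK
  | time hst hK hurgent => exact .delay ((delayStep_iff hs ht).2 ⟨hst, hK, hurgent⟩)
  | bcst htr hl hg hrecv hK hst =>
    refine closedStep_of_bcst hA hs ht ⟨htr, hl, hg⟩ hrecv (hst.trans ?_) hK
    exact bcst_target_eq_postAll hs (List.nodup_cons.2 ⟨fun hi => (mem_RSlist.1 hi).1 rfl,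
      RSlist_nodup⟩) fun k hk => (hrecv k (mem_RSlist.1 hk)).1

theorem step_of_netStep_tau (hA : ∀ i, (N.A i).Composable) (hs : s ∈ N.states)
    (h : NetStep N.A Set.univ b s .tau t) : N.Step s (.disc .tau) t := by
  cases h with
  | tau _ h hK =>
    obtain ⟨l, g, ρ, l', ⟨htr, hl, hg⟩, hb, rfl⟩ := h.enabled_post nofun
    exact .tau htr hl hg rfl ((noCommitted_or_iff hb).1 hK)
  | @sync b b' _ _ _ i j c _ _ hij h h' hK =>
    obtain ⟨l, g, ρ, l', ⟨htr, hl, hg⟩, hb, rfl⟩ := h.enabled_post nofun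
    obtain ⟨m, g', σ, m', hj, hb', rfl⟩ := h'.enabled_post nofun
    obtain ⟨htr', hl', hg'⟩ := (h.enabled_input_iff (N.compat j i hij.symm) (hA j)
      (legal_of_mem_states hs j).subset_dom (.inr ⟨c, rfl⟩)).1 hj
    exact .sync hij htr hl hg htr' hl' hg' (sync_target_eq_post hs hij htr').symm
      ((noCommitted_or_iff (by rw [Bool.or_eq_true, hb, hb'])).1 hK)

theorem step_of_netStep_bsend (hA : ∀ i, (N.A i).Composable) (hs : s ∈ N.states)
    (h : NetStep N.A Set.univ b s (.bsend δ) t)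
    (hK : ∀ k ∈ Set.univ, (N.A k).InCommitted s → b = true) : N.Step s (.disc .tau) t := by
  cases h with
  | @snd b b' _ _ _ i _ _ h hr =>
  obtain ⟨li, gi, ρi, li', hi, hb, rfl⟩ := h.enabled_post nofun
  obtain ⟨l, l', g, ρ, hrecv, hb', rfl⟩ := hr.exists_eq_postAll N.pairwise_compatible hA
    RSlist_nodup (mem_RSlist_iff_canReceive hA hs h)
  have hiL : i ∉ N.RSlist δ i s := fun hi => (mem_RSlist.1 hi).1 rfl
  have hne : ∀ j ∈ N.RSlist δ i s, j ≠ i := fun j hj => ne_of_mem_of_not_mem hj hiL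
  have hrecv' : ∀ j ∈ N.RSlist δ i s, (N.A j).Enabled s (Function.update l i li j)
      (Function.update g i gi j) (.brecv δ) (Function.update ρ i ρi j)
      (Function.update l' i li' j) := fun j hj => by
    simp only [Function.update_of_ne (hne j hj)]
    exact (h.enabled_input_iff (N.compat j i (hne j hj)) (hA j)
      (legal_of_mem_states hs j).subset_dom (.inl ⟨δ, rfl⟩)).1 (hrecv j hj)
  refine .bcst (i := i) (δ := δ) (l := Function.update l i li) (l' := Function.update l' i li')
    (g := Function.update g i gi) (ρ := Function.update ρ i ρi)
    (by simpa only [Function.update_self] using hi.1)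
    (by simpa only [Function.update_self] using hi.2.1)
    (by simpa only [Function.update_self] using hi.2.2)
    (fun j hj => hrecv' j (mem_RSlist.2 hj)) ((noCommitted_or_iff ?_).1 hK) ?_
  · simp only [Bool.or_eq_true, hb, hb', Function.update_self, ← mem_RSlist]
    exact or_congr_right (exists_congr fun j => and_congr_right fun hj => by
      rw [Function.update_of_ne (hne j hj)])
  · rw [bcst_target_eq_postAll hs (List.nodup_cons.2 ⟨hiL, RSlist_nodup⟩)
      fun j hj => (hrecv' j hj).1, postAll_update hiL, Function.update_self, Function.update_self]

theorem step_of_closedStep (hA : ∀ i, (N.A i).Composable) (hs : s ∈ N.states) (ht : t ∈ N.states)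
    (h : ClosedStep N.A Set.univ s α t) : N.Step s α t := by
  cases h with
  | tau h => exact step_of_netStep_tau hA hs h
  | bcst h hK => exact step_of_netStep_bsend hA hs h hK
  | delay h =>
    obtain ⟨hst, hK, hurgent⟩ := (delayStep_iff hs ht).1 h
    exact .time hst hK hurgent

theorem step_iff_closedStep (hA : ∀ i, (N.A i).Composable) (hs : s ∈ N.states)
    (ht : t ∈ N.states) : N.Step s α t ↔ ClosedStep N.A Set.univ s α t :=
  ⟨closedStep_of_step hA hs ht, step_of_closedStep hA hs ht⟩

theorem represents_parAll_ttsb (hA : ∀ i, (N.A i).Composable) :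
    Represents (TTSB.parAll fun i => (N.A i).ttsb) N.A Set.univ := by
  rw [← Set.range_id]
  exact represents_parAll N.pairwise_compatible hA id Function.injective_id

theorem ttsb_S_eq (hA : ∀ i, (N.A i).Composable) : N.ttsb.S = N.states :=
  (represents_parAll_ttsb hA).S_eq.trans netStates_univ

theorem ttsb_s0_eq (N : NTA X D Δ C n) : N.ttsb.s0 = N.s0 := by
  refine (TTSB.parAll_s0 _).trans (PVal.mergeAll_override _ _ fun i j hij => ?_)
  have hdom : (N.A j).v0.dom = (N.A j).V := (N.A j).v0_mem
  change Disjoint ((N.A i).locVal (N.A i).l0).dom (N.A j).v0.dom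
  rw [TA.locVal_dom, Set.disjoint_singleton_left, hdom]
  exact (N.compat i j hij).loc_left

theorem restrictStep_iff (hA : ∀ i, (N.A i).Composable) (hs : s ∈ N.states) :
    (∃ b, TTSB.RestrictStep (TTSB.parAll fun i => (N.A i).ttsb) Set.univ Set.univ b s α t) ↔
      ClosedStep N.A Set.univ s α t := by
  have hrep := represents_parAll_ttsb hA
  have hs' : s ∈ netStates N.A Set.univ := netStates_univ.symm.le hs
  have hcomm : ∀ b : Bool, ((TTSB.parAll fun i => (N.A i).ttsb).Comm s → b = true) ↔
      ∀ k ∈ Set.univ, (N.A k).InCommitted s → b = true := fun b => by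
    simp only [hrep.comm_iff N.pairwise_compatible hA hs', forall_exists_index, and_imp]
  constructor
  · rintro ⟨b, h⟩
    cases h with
    | keep h hB hF =>
      match α, h, hB, hF with
      | .delay d, h, _, _ => exact .delay (hrep.delay_iff.1 h).2.2
      | .disc .tau, h, _, _ => exact .tau (hrep.disc_iff.1 h).2
      | .disc (.bsend δ), _, hB, _ => exact absurd rfl (hB δ trivial).1
      | .disc (.brecv δ), _, hB, _ => exact absurd rfl (hB δ trivial).2
      | .disc (.csend c), _, _, hF => exact absurd rfl (hF c trivial).1
      | .disc (.crecv c), _, _, hF => exact absurd rfl (hF c trivial).2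
    | hide _ h hc => exact .bcst (hrep.disc_iff.1 h).2 ((hcomm b).1 hc)
  · intro h
    cases h with
    | tau h => exact ⟨_, .keep (hrep.disc_iff.2 ⟨hs', h⟩) (by simp) (by simp)⟩
    | bcst h hK => exact ⟨_, .hide trivial (hrep.disc_iff.2 ⟨hs', h⟩) ((hcomm _).2 hK)⟩
    | delay h => exact ⟨_, .keep (hrep.delay_iff.2 ⟨hs', rfl, h⟩) (by simp) (by simp)⟩

theorem ttsb_tr_iff_closedStep (hA : ∀ i, (N.A i).Composable) (hs : s ∈ N.states) :
    (N.ttsb.tr true s α t ∨ N.ttsb.tr false s α t) ↔ ClosedStep N.A Set.univ s α t := by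
  rw [← restrictStep_iff hA hs, Bool.exists_bool, or_comm]
  rfl

end NTA

end BroadcastTA

theorem mainTheorem2_general {X Y : Type*} {D : Y → Type} {Δ C : Type*} {n : ℕ}
    (N : NTA X D Δ C n) (hA : ∀ i, (N.A i).Composable) :
    Nonempty (LTS.Iso N.lts N.compLts) :=
  ⟨{ toEquiv := Equiv.setCongr (NTA.ttsb_S_eq hA).symm
     map_init := Subtype.ext N.ttsb_s0_eq.symm
     map_tr := fun s _ t =>
      (NTA.step_iff_closedStep hA s.2 t.2).trans (NTA.ttsb_tr_iff_closedStep hA s.2).symm }⟩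

theorem mainTheorem2 {X Y : Type*} {D : Y → Type} {Δ C : Type*} {n : ℕ}
    (N : NTA X D Δ C n)
    (hax : ∀ i, (N.A i).Axioms)
    (hrec : ∀ i, (N.A i).Receptive) :
    Nonempty (LTS.Iso N.lts N.compLts) :=
  mainTheorem2_general N fun i =>
    ⟨(hax i).inv, (hax i).input_guard, (hax i).committed, (hax i).recv_update, hrec i⟩
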